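/- Let $M>0$, $\lambda>0$, $\delta=\lambda M$. For an integer $l\ge 2$ let $K=lM$ and consider the Markov chain on $[0,K]$ $$B(i+1)=\min\bigl(B(i)-M\,\mathbf 1_{B(i)>M}+X(i),\,K\bigr),$$ where the $X(i)$ are i.i.d. exponential with pdf $\lambda e^{-\lambda x}$, $x\ge0$, and $X(i)$ is independent of $B(i)$. This chain has a limiting distribution (it is stationary, and the law of $B(n)$ converges to it in total variation from every initial distribution on $[0,K]$), which consists of a pdf $g=g^{(l)}$ on $[0,K)$ (right-continuous version) and an atom $\pi(K)$ at $K$. Let $W_0\ge-1$ and $W_{-1}\le-1$ be the two real branches of the Lambert W function and, for an integer $n_c$ with $0\le n_c\le l-1$, define (with $0^0=1$) $$d=\frac{-\delta-W_j(-\delta e^{-\delta})}{M},\quad j=-1\text{ if }0<\delta\le1,\quad j=0\text{ if }\delta>1,$$ $$\Sigma_1=e^{\lambda K}\Bigl[1+\sum_{q=1}^{l-1}\tfrac{e^{-\delta q}}{(q-1)!}(\delta q-\lambda K)^{q-1}\bigl(-\tfrac{\lambda K}{q}+\delta-1\bigr)\Bigr],$$ $$\Sigma_2=\begin{cases}\frac{\lambda\Sigma_1}{d}\bigl(e^{d(K-n_cM)}-\delta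 e^{dM}\bigr),&\delta\ne1,\\ \lambda\Sigma_1\bigl(\tfrac M2+K-(n_c+1)M\bigr),&\delta=1,\end{cases}$$ $$\tilde\pi(K)=\Bigl[1+\Sigma_2+\sum_{n=0}^{n_c-1}e^{n\delta}\sum_{q=0}^{n}\tfrac{(\delta e^{-\delta})^q}{q!}\bigl(e^{\delta}(q-n-1)^q-(q-n)^q\bigr)\Bigr]^{-1},\qquad c=\tilde\pi(K)\,\lambda\,\Sigma_1,$$ $$\tilde g(x)=\begin{cases}c\,\frac{\lambda e^{dM}}{d}\,(e^{dx}-1)\ \ (\delta\neq1),\qquad c\lambda x\ \ (\delta=1),&0\le x<M,\\ c\,e^{dx},&M\le x<K-n_cM,\\ \tilde\pi(K)\lambda e^{-\lambda(x-K)}\Bigl[1+\sum_{q=1}^{n}\frac{e^{-\delta q}}{(q-1)!}(\delta q+\lambda(x-K))^{q-1}\bigl(\frac{\lambda(x-K)}{q}+\delta-1\bigr)\Bigr],&K-(n+1)M\le x<K-nM,\ 0\le n\le n_c-1.\end{cases}$$ (a) For every $\delta>0$, $l\ge2$ and $0\le n_c\le l-1$, $(\tilde g,\tilde\pi(K))$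 is a probability distribution: $\tilde\pi(K)>0$, $\tilde g\ge0$ on $[0,K)$ and $\int_0^K\tilde g(x)\,dx+\tilde\pi(K)=1$. On $[0,M)$ it satisfies the Volterra equation $$\tilde g(x)=\int_0^x\lambda e^{-\lambda(x-u)}\tilde g(u)\,du+\int_M^{M+x}\lambda e^{-\lambda(x-u+M)}\,c\,e^{du}\,du .$$ On $[K-n_cM,K)$ it is the exact pdf rescaled: $\pi(K)>0$ and $\tilde g(x)=\frac{\tilde\pi(K)}{\pi(K)}\,g(x)$. (b) Let $\delta>1$ and let $l\to\infty$ with $M,\lambda$ fixed and any choice of $n_c=n_c(l)$ with $0\le n_c\le l-1$ for all large $l$. Then the approximation error vanishes: $\sup_{0\le x<lM}|g^{(l)}(x)-\tilde g^{(l)}(x)|\to0$, $\pi(K)\to0$ and $\tilde\pi(K)\to0$. Moreover, uniformly on $[0,M]$, $$\lim_{l\to\infty}g^{(l)}(x)=\lim_{l\to\infty}\tilde g^{(l)}(x)=\frac1M\bigl(1-e^{px}\bigr),\qquad p=\frac{-\delta-W_0(-\delta e^{-\delta})}{M}.$$ -/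

import Mathlib

open MeasureTheory Filter Topology Set

namespace EnergyBuffer

noncomputable section

/-! ### The storage process -/

/-- One step of the storage equation `B(i+1) = min (B(i) - M 1_{B(i) > M} + X(i), K)`, from buffer
content `u = B(i)` and harvested energy `x = X(i)`. -/
def storageStep (M K u x : ℝ) : ℝ :=
  min (u - (if M < u then M else 0) + x) K

/-- The law of `B(i+1)` when `B(i)` has law `μ` and, independently, `X(i)` is exponentially
distributed with density `lam * exp (-lam * x)` on `x ≥ 0`. -/
def nextLaw (M lam K : ℝ) (μ : Measure ℝ) : Measure ℝ :=
  (μ.prod (ProbabilityTheory.expMeasure lam)).map fun z => storageStep M K z.1 z.2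

/-- `ν` is the limiting distribution of the storage process with state space `[0, K]`: it is a
stationary distribution, and the law of `B(n)` converges to it in total variation as `n → ∞`,
from every initial distribution on `[0, K]`. -/
structure IsLimitingDistribution (M lam K : ℝ) (ν : Measure ℝ) : Prop where
  prob : IsProbabilityMeasure ν
  support : ν (Icc 0 K)ᶜ = 0
  stationary : nextLaw M lam K ν = ν
  limiting : ∀ μ : Measure ℝ, IsProbabilityMeasure μ → μ (Icc 0 K)ᶜ = 0 →
    ∀ ε : ℝ, 0 < ε → ∀ᶠ n : ℕ in atTop, ∀ A : Set ℝ, MeasurableSet A →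
      |((nextLaw M lam K)^[n] μ).real A - ν.real A| ≤ ε

/-- `g` on `[0, K)` is the limiting pdf of the buffer content and `a` is the limiting probability of
a full buffer. A pdf is determined up to null sets only; the right-continuous version is meant, and
it is unique on `[0, K)`. -/
structure IsLimitingPdf (M lam K : ℝ) (g : ℝ → ℝ) (a : ℝ) : Prop where
  nonneg : ∀ x ∈ Ico 0 K, 0 ≤ g x
  right_cont : ∀ x ∈ Ico 0 K, ContinuousWithinAt g (Ici x) x
  integrable : IntegrableOn g (Ioo 0 K)
  atom_nonneg : 0 ≤ a
  law : IsLimitingDistribution M lam K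
    ((volume.restrict (Ioo 0 K)).withDensity (fun x => ENNReal.ofReal (g x)) +
      ENNReal.ofReal a • Measure.dirac K)

/-! ### The two real branches of the Lambert W function -/

/-- Order `0`: for `z ≥ -1/e`, the solution `w ≥ -1` of `w * exp w = z`. -/
def lambertW0 (z : ℝ) : ℝ :=
  Function.invFunOn (fun w : ℝ => w * Real.exp w) (Ici (-1)) z

/-- Order `-1`: for `-1/e ≤ z < 0`, the solution `w ≤ -1` of `w * exp w = z`. -/
def lambertWNegOne (z : ℝ) : ℝ :=
  Function.invFunOn (fun w : ℝ => w * Real.exp w) (Iic (-1)) z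

/-! ### The approximate distribution, for buffer size `K = l * M`; `lam * M` is `δ` -/

/-- The rate `d`. -/
def approxRate (M lam : ℝ) : ℝ :=
  if lam * M ≤ 1 then
    (-(lam * M) - lambertWNegOne (-(lam * M) * Real.exp (-(lam * M)))) / M
  else
    (-(lam * M) - lambertW0 (-(lam * M) * Real.exp (-(lam * M)))) / M

/-- The expression `g_n(x) / (π(K) * lam)` of the exact pdf in the `n`-th section
`K - (n+1) M ≤ x < K - n M`. -/
def sectionExpr (M lam : ℝ) (l n : ℕ) (x : ℝ) : ℝ :=
  Real.exp (-lam * (x - l * M)) *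
    (1 + ∑ q ∈ Finset.Icc 1 n,
      Real.exp (-(lam * M) * q) / ((q - 1).factorial : ℝ) *
        (lam * M * q + lam * (x - l * M)) ^ (q - 1) *
        (lam * (x - l * M) / q + lam * M - 1))

/-- `Σ₁`. -/
def sigma1 (M lam : ℝ) (l : ℕ) : ℝ :=
  Real.exp (lam * (l * M)) *
    (1 + ∑ q ∈ Finset.Icc 1 (l - 1),
      Real.exp (-(lam * M) * q) / ((q - 1).factorial : ℝ) *
        (lam * M * q - lam * (l * M)) ^ (q - 1) *
        (-(lam * (l * M)) / q + lam * M - 1))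

/-- `Σ₂`. -/
def sigma2 (M lam : ℝ) (l nc : ℕ) : ℝ :=
  if lam * M = 1 then
    lam * sigma1 M lam l * (M / 2 + l * M - (nc + 1) * M)
  else
    lam * sigma1 M lam l / approxRate M lam *
      (Real.exp (approxRate M lam * (l * M - nc * M)) -
        lam * M * Real.exp (approxRate M lam * M))

/-- The approximate probability of a full buffer. -/
def approxAtom (M lam : ℝ) (l nc : ℕ) : ℝ :=
  (1 + sigma2 M lam l nc +
    ∑ n ∈ Finset.range nc, Real.exp (n * (lam * M)) *
      ∑ q ∈ Finset.range (n + 1),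
        (lam * M * Real.exp (-(lam * M))) ^ q / (q.factorial : ℝ) *
          (Real.exp (lam * M) * ((q : ℝ) - (n + 1)) ^ q - ((q : ℝ) - n) ^ q))⁻¹

/-- The constant `c`. -/
def approxCoeff (M lam : ℝ) (l nc : ℕ) : ℝ :=
  approxAtom M lam l nc * lam * sigma1 M lam l

/-- The approximate pdf on `[0, M)`. -/
def approxFirst (M lam : ℝ) (l nc : ℕ) (x : ℝ) : ℝ :=
  if lam * M = 1 then
    approxCoeff M lam l nc * lam * x
  else
    approxCoeff M lam l nc * (lam * Real.exp (approxRate M lam * M) / approxRate M lam) *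
      (Real.exp (approxRate M lam * x) - 1)

/-- The exponential `c * exp (d * x)`, used on `[M, K - nc * M)`. -/
def approxMiddle (M lam : ℝ) (l nc : ℕ) (x : ℝ) : ℝ :=
  approxCoeff M lam l nc * Real.exp (approxRate M lam * x)

/-- The approximate pdf on `[0, K)`. On `[K - nc * M, K)` it is the exact expression with the
approximate atom in place of the exact one; the section `n` with
`K - (n+1) M ≤ x < K - n M` is `n = ⌈(K - x) / M⌉ - 1`. -/
def approxPdf (M lam : ℝ) (l nc : ℕ) (x : ℝ) : ℝ :=
  if x < M then approxFirst M lam l nc x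
  else if x < l * M - nc * M then approxMiddle M lam l nc x
  else approxAtom M lam l nc * lam * sectionExpr M lam l (⌈(l * M - x) / M⌉₊ - 1) x

end

end EnergyBuffer

open EnergyBuffer

/-!
The stationary law is governed by one function. Seen from the top of the buffer, the stationary
mass of `(K - y, K]`, `y ≤ K - M`, in units of the atom at `K`, is a function `V = tailFun M lam`
of `y` that does not depend on `K`: it solves the delay equation `V' y = lam * (V y - V (y - M))`
of the M/D/1 queue with a unit jump at `0`, and is an explicit finite sum.
Level crossing balance says that the density at `x` is `lam`
times the stationary mass of `(max x M, x + M]`, so the density (`exactPdf`) is a difference of two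
values of `V`; the normalisation then gives the atom `(1 + lam * M * V (K - M))⁻¹` (`exactAtom`).
The section expressions, `Σ₁` and the double sum of the approximate normalisation are differences
and values of `V` too (`sectionExpr_eq`, `sigma1_eq`, `one_add_sum_eq`), and `V y - V (y - M)` is
positive for `y > 0` (`tailFun_diff_pos`).

Stationarity (`nextLaw_exactLaw`): if `F` is the distribution function of the content and `g` its
density, level crossing says that after the possible removal of `M` the distribution function is
`F + g / lam`, and convolution with the exponential law turns this back into `F`. Convergence in total
variation from every start is Doeblin's argument (`abs_stepProb_sub_le`): an arrival larger than `K`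
fills the buffer. Hence the limiting law is unique, and by right continuity so is its density
(`IsLimitingPdf.eq_exact`).

The rate `d` of the approximation is a root of `d + lam = lam * exp (d * M)` (`approxRate_add`); the
area of the approximate law and its Volterra equation are then direct computations.

For a load `lam * M > 1` one has `d < 0`, and tilting by `exp (d * y)` turns `V` into the same function
for the conjugate rate `d + lam` (`tailFun_eq_exp_mul`), whose load is below `1`. That function is
increasing and bounded and so converges, to a limit found from its averaging identity
(`tendsto_tailFun`). Therefore `exp (d * K) * V (K - x)` converges to a multiple of `exp (d * x)`
uniformly in `x ≥ 0` (`tendsto_scaledTail`), and both densities, being made of such values, converge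
uniformly to the same limit `limitPdf`; in the approximate normalisation the terms that depend on `nc`
cancel (`tendsto_scaled_approxAtom`).
-/

namespace EnergyBuffer

variable {M lam r K : ℝ}

/-! ### The M/D/1 tail function -/

/-- The `q`-th term of `tailFun`, without the cut-off `q * M < y`. -/
noncomputable def tailPoly (M r : ℝ) (q : ℕ) (y : ℝ) : ℝ :=
  (r * (q * M - y)) ^ q / (q.factorial : ℝ) * Real.exp (r * (y - q * M))

/-- The tail of the stationary law seen from the top of the buffer, in units of the atom: the
stationary mass of `(K - y, K]` is `tailFun M lam y` times the mass of `{K}`, as long as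
`y ≤ K - M`. It vanishes for `y ≤ 0` and jumps to `1` at `0`; the version chosen is continuous
from the left. Up to normalisation it is the waiting time distribution function of the M/D/1 queue
with service time `M` and arrival rate `r`. -/
noncomputable def tailFun (M r y : ℝ) : ℝ :=
  ∑ q ∈ Finset.range ⌈y / M⌉₊, tailPoly M r q y

theorem continuous_tailPoly (q : ℕ) : Continuous (tailPoly M r q) := by
  unfold tailPoly; fun_prop

theorem hasDerivAt_tailPoly_zero (y : ℝ) :
    HasDerivAt (tailPoly M r 0) (r * tailPoly M r 0 y) y := by
  have h : tailPoly M r 0 = fun y => Real.exp (r * y) := by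
    ext y; simp [tailPoly]
  rw [h]
  have := ((hasDerivAt_id y).const_mul r).exp
  simpa [mul_comm] using this

/-- The terms solve the delay equation in cascade. -/
theorem hasDerivAt_tailPoly_succ (q : ℕ) (y : ℝ) :
    HasDerivAt (tailPoly M r (q + 1)) (r * (tailPoly M r (q + 1) y - tailPoly M r q (y - M))) y := by
  have h1 : HasDerivAt (fun y : ℝ => r * (((q + 1 : ℕ) : ℝ) * M - y)) (r * (-1)) y :=
    ((hasDerivAt_id y).const_sub _).const_mul r
  have h2 : HasDerivAt (fun y : ℝ => r * (y - ((q + 1 : ℕ) : ℝ) * M)) (r * 1) y :=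
    ((hasDerivAt_id y).sub_const _).const_mul r
  have h := ((h1.pow (q + 1)).div_const (((q + 1).factorial : ℕ) : ℝ)).mul h2.exp
  refine h.congr_deriv ?_
  have e1 : r * ((q : ℝ) * M - (y - M)) = r * (((q + 1 : ℕ) : ℝ) * M - y) := by push_cast; ring
  have e2 : r * (y - M - (q : ℝ) * M) = r * (y - ((q + 1 : ℕ) : ℝ) * M) := by push_cast; ring
  have e3 : (((q + 1).factorial : ℕ) : ℝ) = ((q : ℝ) + 1) * (q.factorial : ℝ) := by
    rw [Nat.factorial_succ]; push_cast; ring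
  have h4 : (q.factorial : ℝ) ≠ 0 := by positivity
  have h5 : (q : ℝ) + 1 ≠ 0 := by positivity
  simp only [tailPoly, e1, e2, e3, Pi.pow_apply, Nat.add_sub_cancel]
  generalize r * (((q + 1 : ℕ) : ℝ) * M - y) = A
  generalize Real.exp (r * (y - ((q + 1 : ℕ) : ℝ) * M)) = E
  push_cast
  field_simp
  ring

theorem tailFun_of_nonpos (hM : 0 < M) {y : ℝ} (hy : y ≤ 0) : tailFun M r y = 0 := by
  have : ⌈y / M⌉₊ = 0 := Nat.ceil_eq_zero.2 (div_nonpos_of_nonpos_of_nonneg hy hM.le)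
  simp [tailFun, this]

/-- The cut-off in `tailFun` may be read off term by term. -/
theorem tailFun_eq_sum (hM : 0 < M) {y : ℝ} {N : ℕ} (hy : y ≤ N * M) :
    tailFun M r y =
      ∑ q ∈ Finset.range N, (Ioi (q * M)).indicator (tailPoly M r q) y := by
  have h1 : ⌈y / M⌉₊ ≤ N := Nat.ceil_le.2 ((div_le_iff₀ hM).2 hy)
  rw [tailFun, ← Finset.sum_subset (Finset.range_mono h1)]
  · refine Finset.sum_congr rfl fun q hq => ?_
    have : (q : ℝ) * M < y := (lt_div_iff₀ hM).1 (Nat.lt_ceil.1 (Finset.mem_range.1 hq))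
    rw [indicator_of_mem (by exact this)]
  · intro q _ hq
    have : y ≤ (q : ℝ) * M :=
      (div_le_iff₀ hM).1 (Nat.ceil_le.1 (not_lt.1 (fun h => hq (Finset.mem_range.2 h))))
    rw [indicator_of_notMem (by simpa using this)]

theorem intervalIntegrable_indicator_tailPoly (q : ℕ) (s a b : ℝ) :
    IntervalIntegrable ((Ioi s).indicator (tailPoly M r q)) volume a b := by
  have h := (continuous_tailPoly (M := M) (r := r) q).intervalIntegrable (μ := volume) a b
  rw [intervalIntegrable_iff] at h ⊢
  exact h.indicator measurableSet_Ioi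

theorem exists_nat_mul_ge (hM : 0 < M) (y : ℝ) : ∃ N : ℕ, y ≤ N * M := by
  obtain ⟨N, hN⟩ := exists_nat_ge (y / M)
  exact ⟨N, (div_le_iff₀ hM).1 hN⟩

theorem intervalIntegrable_tailFun (hM : 0 < M) (a b : ℝ) :
    IntervalIntegrable (tailFun M r) volume a b := by
  obtain ⟨N, hN⟩ := exists_nat_mul_ge hM (max a b)
  have h : IntervalIntegrable (∑ q ∈ Finset.range N, (Ioi (q * M)).indicator (tailPoly M r q))
      volume a b :=
    IntervalIntegrable.sum _ fun q _ => intervalIntegrable_indicator_tailPoly q _ a b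
  refine h.congr fun y hy => ?_
  rw [Finset.sum_apply]
  exact (tailFun_eq_sum hM (hy.2.trans hN)).symm

theorem intervalIntegrable_tailFun_sub (hM : 0 < M) (s a b : ℝ) :
    IntervalIntegrable (fun t => tailFun M r (t - s)) volume a b := by
  have := (intervalIntegrable_tailFun (r := r) hM (a - s) (b - s)).comp_sub_right s
  simpa using this

theorem indicator_tailPoly_zero_eq {y : ℝ} (hy : 0 < y) :
    (Ioi (((0 : ℕ) : ℝ) * M)).indicator (tailPoly M r 0) y =
      1 + r * ∫ t in (0 : ℝ)..y, (Ioi (((0 : ℕ) : ℝ) * M)).indicator (tailPoly M r 0) t := by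
  have h1 : ∫ t in (0 : ℝ)..y, (Ioi (((0 : ℕ) : ℝ) * M)).indicator (tailPoly M r 0) t =
      ∫ t in (0 : ℝ)..y, tailPoly M r 0 t := by
    refine intervalIntegral.integral_congr_uIoo fun t ht => ?_
    rw [uIoo_of_le hy.le] at ht
    exact indicator_of_mem (by simpa using ht.1) _
  have h2 := intervalIntegral.integral_eq_sub_of_hasDerivAt (a := 0) (b := y)
    (fun t _ => hasDerivAt_tailPoly_zero (M := M) (r := r) t)
    ((continuous_tailPoly (M := M) (r := r) 0).const_mul r |>.intervalIntegrable _ _)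
  rw [intervalIntegral.integral_const_mul] at h2
  rw [h1, h2, indicator_of_mem (by simpa using hy)]
  simp [tailPoly]

theorem indicator_tailPoly_succ_eq (hM : 0 < M) (q : ℕ) {y : ℝ} (hy : 0 ≤ y) :
    (Ioi (((q + 1 : ℕ) : ℝ) * M)).indicator (tailPoly M r (q + 1)) y =
      r * ∫ t in (0 : ℝ)..y,
        ((Ioi (((q + 1 : ℕ) : ℝ) * M)).indicator (tailPoly M r (q + 1)) t -
          (Ioi ((q : ℝ) * M)).indicator (tailPoly M r q) (t - M)) := by
  set s : ℝ := ((q + 1 : ℕ) : ℝ) * M with hs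
  have hs0 : 0 ≤ s := by positivity
  have hmem : ∀ t : ℝ, t - M ∈ Ioi ((q : ℝ) * M) ↔ t ∈ Ioi s := by
    intro t; simp only [mem_Ioi, hs]; push_cast
    constructor <;> intro h <;> linarith
  have hF : ∀ t : ℝ, ((Ioi s).indicator (tailPoly M r (q + 1)) t -
      (Ioi ((q : ℝ) * M)).indicator (tailPoly M r q) (t - M)) =
      (Ioi s).indicator (fun t => tailPoly M r (q + 1) t - tailPoly M r q (t - M)) t := by
    intro t
    by_cases ht : t ∈ Ioi s
    · rw [indicator_of_mem ht, indicator_of_mem ht, indicator_of_mem ((hmem t).2 ht)]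
    · rw [indicator_of_notMem ht, indicator_of_notMem ht,
        indicator_of_notMem (fun h => ht ((hmem t).1 h)), sub_zero]
  simp_rw [hF]
  have hc : Continuous fun t => tailPoly M r (q + 1) t - tailPoly M r q (t - M) :=
    (continuous_tailPoly _).sub ((continuous_tailPoly q).comp (continuous_id.sub continuous_const))
  have hint : ∀ a b : ℝ, IntervalIntegrable ((Ioi s).indicator
      (fun t => tailPoly M r (q + 1) t - tailPoly M r q (t - M))) volume a b := by
    intro a b
    have h := hc.intervalIntegrable (μ := volume) a b
    rw [intervalIntegrable_iff] at h ⊢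
    exact h.indicator measurableSet_Ioi
  have hzero : ∀ z : ℝ, 0 ≤ z → z ≤ s → ∫ t in (0 : ℝ)..z, (Ioi s).indicator
      (fun t => tailPoly M r (q + 1) t - tailPoly M r q (t - M)) t = 0 := by
    intro z hz hzs
    rw [intervalIntegral.integral_congr_uIoo (g := fun _ => (0 : ℝ))]
    · simp
    · intro t ht
      rw [uIoo_of_le hz] at ht
      exact indicator_of_notMem (by simpa using (ht.2.trans_le hzs).le) _
  rcases le_or_gt y s with hys | hys
  · rw [hzero y hy hys, mul_zero, indicator_of_notMem (by simpa using hys)]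
  · rw [← intervalIntegral.integral_add_adjacent_intervals (hint 0 s) (hint s y),
      hzero s hs0 le_rfl, zero_add]
    rw [intervalIntegral.integral_congr_uIoo
      (g := fun t => tailPoly M r (q + 1) t - tailPoly M r q (t - M))]
    · rw [← intervalIntegral.integral_const_mul,
        intervalIntegral.integral_eq_sub_of_hasDerivAt
          (fun t _ => hasDerivAt_tailPoly_succ (M := M) (r := r) q t)
          ((hc.const_mul r).intervalIntegrable _ _),
        indicator_of_mem (by simpa using hys)]
      simp [tailPoly, hs]
    · intro t ht
      rw [uIoo_of_le hys.le] at ht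
      exact indicator_of_mem (by simpa using ht.1) _

/-- The delay equation of `tailFun`, integrated from `0`, where the jump of `1` sits. -/
theorem tailFun_eq_one_add (hM : 0 < M) {y : ℝ} (hy : 0 < y) :
    tailFun M r y = 1 + r * ∫ t in (0 : ℝ)..y, (tailFun M r t - tailFun M r (t - M)) := by
  obtain ⟨N, hN⟩ := exists_nat_mul_ge hM y
  have hN1 : y ≤ (N + 1 : ℕ) * M := by push_cast; linarith
  have hint : ∫ t in (0 : ℝ)..y, (tailFun M r t - tailFun M r (t - M)) =
      ∫ t in (0 : ℝ)..y, ((Ioi (((0 : ℕ) : ℝ) * M)).indicator (tailPoly M r 0) t +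
        ∑ q ∈ Finset.range N,
          ((Ioi (((q + 1 : ℕ) : ℝ) * M)).indicator (tailPoly M r (q + 1)) t -
            (Ioi ((q : ℝ) * M)).indicator (tailPoly M r q) (t - M))) := by
    refine intervalIntegral.integral_congr_uIoo fun t ht => ?_
    rw [uIoo_of_le hy.le] at ht
    rw [tailFun_eq_sum hM (ht.2.le.trans hN1),
      tailFun_eq_sum (y := t - M) (N := N) hM (by linarith [ht.2]),
      Finset.sum_range_succ', Finset.sum_sub_distrib]
    ring
  have hi : ∀ q : ℕ, IntervalIntegrable (fun t =>
      (Ioi (((q + 1 : ℕ) : ℝ) * M)).indicator (tailPoly M r (q + 1)) t -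
            (Ioi ((q : ℝ) * M)).indicator (tailPoly M r q) (t - M)) volume 0 y := by
    intro q
    refine (intervalIntegrable_indicator_tailPoly _ _ _ _).sub ?_
    have := (intervalIntegrable_indicator_tailPoly (M := M) (r := r) q (q * M)
      (0 - M) (y - M)).comp_sub_right M
    simpa using this
  rw [hint, intervalIntegral.integral_add (intervalIntegrable_indicator_tailPoly _ _ _ _)
      (by simpa only [Finset.sum_fn] using IntervalIntegrable.sum (Finset.range N) fun q _ => hi q),
    intervalIntegral.integral_finsetSum fun q _ => hi q, tailFun_eq_sum hM hN1,
    Finset.sum_range_succ', mul_add, Finset.mul_sum, indicator_tailPoly_zero_eq hy,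
    Finset.sum_congr rfl fun q _ => indicator_tailPoly_succ_eq (r := r) hM q hy.le]
  ring

theorem intervalIntegrable_tailFun_diff (hM : 0 < M) (a b : ℝ) :
    IntervalIntegrable (fun t => tailFun M r t - tailFun M r (t - M)) volume a b :=
  (intervalIntegrable_tailFun hM a b).sub (intervalIntegrable_tailFun_sub hM M a b)

theorem continuousOn_tailFun (hM : 0 < M) : ContinuousOn (tailFun M r) (Ioi 0) := by
  have h := intervalIntegral.continuous_primitive
    (fun a b => intervalIntegrable_tailFun_diff (r := r) hM a b) 0
  exact (continuous_const.add (h.const_mul r)).continuousOn.congr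
    fun y hy => tailFun_eq_one_add hM hy

theorem continuousAt_tailFun (hM : 0 < M) {y : ℝ} (hy : 0 < y) : ContinuousAt (tailFun M r) y :=
  (continuousOn_tailFun hM).continuousAt (Ioi_mem_nhds hy)

theorem continuousWithinAt_tailFun (hM : 0 < M) (y : ℝ) :
    ContinuousWithinAt (tailFun M r) (Iic y) y := by
  rcases lt_or_ge 0 y with hy | hy
  · exact (continuousAt_tailFun hM hy).continuousWithinAt
  · exact (continuousWithinAt_const (b := (0 : ℝ))).congr
      (fun x hx => tailFun_of_nonpos hM (le_trans hx hy)) (tailFun_of_nonpos hM hy)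

/-- The delay equation as an averaging identity over a window of length `M`. -/
theorem tailFun_eq_window (hM : 0 < M) {y : ℝ} (hy : 0 < y) :
    tailFun M r y = 1 + r * ∫ t in (y - M)..y, tailFun M r t := by
  have h := fun a b => intervalIntegrable_tailFun (r := r) hM a b
  have h0 : ∫ t in (0 - M)..0, tailFun M r t = 0 := by
    rw [intervalIntegral.integral_congr_uIoo (g := fun _ => (0 : ℝ))]
    · simp
    · intro t ht
      rw [uIoo_of_le (by linarith)] at ht
      exact tailFun_of_nonpos hM ht.2.le
  have h1 : ∫ t in (0 : ℝ)..y, tailFun M r (t - M) = ∫ t in (0 - M)..(y - M), tailFun M r t :=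
    intervalIntegral.integral_comp_sub_right (fun t => tailFun M r t) M
  rw [tailFun_eq_one_add hM hy, intervalIntegral.integral_sub (h 0 y)
    (intervalIntegrable_tailFun_sub hM M 0 y), h1,
    ← intervalIntegral.integral_add_adjacent_intervals (h (0 - M) 0) (h 0 (y - M)), h0,
    ← intervalIntegral.integral_add_adjacent_intervals (h (y - M) 0) (h 0 y),
    intervalIntegral.integral_symm 0 (y - M)]
  ring

theorem tailFun_of_le (hM : 0 < M) {y : ℝ} (h0 : 0 < y) (hy : y ≤ M) :
    tailFun M r y = Real.exp (r * y) := by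
  rw [tailFun_eq_sum (N := 1) hM (by simpa using hy)]
  simp [tailPoly, h0]

/-- The difference over one service time is positive: on `(0, M]` by the explicit formula, and
afterwards because it is `r` times its own integral over the preceding window, so that it has no
first zero. -/
theorem tailFun_lt_tailFun_add (hM : 0 < M) (hr : 0 < r) {y : ℝ} (hy : 0 < y) :
    tailFun M r y < tailFun M r (y + M) := by
  have hfirst : ∀ z : ℝ, 0 < z → z ≤ M → tailFun M r z < tailFun M r (z + M) := by
    intro z hz hzM
    rw [tailFun_of_le hM hz hzM, tailFun_eq_sum (N := 2) hM (by push_cast; linarith)]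
    simp only [Finset.sum_range_succ, Finset.sum_range_zero, zero_add]
    rw [indicator_of_mem (by simp; linarith), indicator_of_mem (by simp; linarith)]
    simp only [tailPoly, Nat.cast_zero, Nat.cast_one, zero_mul, one_mul, pow_zero, pow_one,
      Nat.factorial_zero, Nat.factorial_one, div_one, sub_zero]
    have e1 : Real.exp (r * (z + M)) = Real.exp (r * z) * Real.exp (r * M) := by
      rw [← Real.exp_add]; ring_nf
    have e2 : r * (z + M - M) = r * z := by ring
    rw [e1, e2]
    have h1 : r * M + 1 < Real.exp (r * M) := Real.add_one_lt_exp (by positivity)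
    have h2 : r * z ≤ r * M := by gcongr
    have h3 : 0 < Real.exp (r * z) * (Real.exp (r * M) - r * z - 1) :=
      mul_pos (Real.exp_pos _) (by linarith)
    linarith
  by_contra hcon
  have hyM : M ≤ y := by
    by_contra h
    exact hcon (hfirst y hy (not_le.1 h).le)
  set D : ℝ → ℝ := fun z => tailFun M r (z + M) - tailFun M r z with hD
  have hDc : ContinuousOn D (Icc M y) := by
    intro z hz
    have hz0 : 0 < z := hM.trans_le hz.1
    exact ((ContinuousAt.comp (f := fun z => z + M) (continuousAt_tailFun hM (by linarith))
      (by fun_prop)).sub (continuousAt_tailFun hM hz0)).continuousWithinAt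
  -- the compact set of failures would have a least element
  have hcomp : IsCompact (Icc M y ∩ D ⁻¹' Iic 0) :=
    isCompact_Icc.of_isClosed_subset (hDc.preimage_isClosed_of_isClosed isClosed_Icc isClosed_Iic)
      inter_subset_left
  obtain ⟨y0, hy0, hleast⟩ := hcomp.exists_isLeast
    ⟨y, ⟨hyM, le_rfl⟩, by simp only [hD, mem_preimage, mem_Iic]; linarith⟩
  have hpos : ∀ z, 0 < z → z < y0 → 0 < D z := by
    intro z hz hzy
    rcases le_or_gt z M with h | h
    · exact sub_pos.2 (hfirst z hz h)
    · by_contra hn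
      exact absurd (hleast ⟨⟨h.le, hzy.le.trans hy0.1.2⟩, not_lt.1 hn⟩) (not_le.2 hzy)
  -- `y0` is the first point of `[M, y]` where the difference fails to be positive
  have hMy0 : M < y0 := by
    refine lt_of_le_of_ne hy0.1.1 fun h => ?_
    have := hfirst M hM le_rfl
    have h2 := hy0.2
    rw [← h] at h2
    simp only [hD, mem_preimage, mem_Iic] at h2
    linarith
  have h := fun a b => intervalIntegrable_tailFun (r := r) hM a b
  have hDi : ∀ a b, IntervalIntegrable D volume a b := by
    intro a b
    have := (intervalIntegrable_tailFun_sub (r := r) hM (-M) a b)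
    simp only [sub_neg_eq_add] at this
    exact this.sub (h a b)
  have hDeq : D y0 = r * ∫ t in (y0 - M)..y0, D t := by
    have h1 : ∫ t in (y0 - M)..y0, tailFun M r (t + M) =
        ∫ t in (y0 - M + M)..(y0 + M), tailFun M r t :=
      intervalIntegral.integral_comp_add_right (fun t => tailFun M r t) M
    have h2 : IntervalIntegrable (fun t => tailFun M r (t + M)) volume (y0 - M) y0 := by
      have := (intervalIntegrable_tailFun_sub (r := r) hM (-M) (y0 - M) y0)
      simpa only [sub_neg_eq_add] using this
    simp only [hD]
    rw [intervalIntegral.integral_sub h2 (h _ _), h1, tailFun_eq_window hM (by linarith),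
      tailFun_eq_window (y := y0) hM (by linarith)]
    ring_nf
  have hint : 0 < ∫ t in (y0 - M)..y0, D t :=
    intervalIntegral.intervalIntegral_pos_of_pos_on (hDi _ _)
      (fun x hx => hpos x (by linarith [hx.1]) hx.2) (by linarith)
  have : 0 < D y0 := hDeq ▸ mul_pos hr hint
  exact absurd hy0.2 (not_le.2 this)

theorem tailFun_diff_pos (hM : 0 < M) (hr : 0 < r) {y : ℝ} (hy : 0 < y) :
    0 < tailFun M r y - tailFun M r (y - M) := by
  rcases le_or_gt y M with h | h
  · rw [tailFun_of_le hM hy h, tailFun_of_nonpos hM (by linarith), sub_zero]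
    exact Real.exp_pos _
  · have := tailFun_lt_tailFun_add (y := y - M) hM hr (by linarith)
    rw [sub_add_cancel] at this
    exact sub_pos.2 this

theorem one_le_tailFun (hM : 0 < M) (hr : 0 < r) {y : ℝ} (hy : 0 < y) : 1 ≤ tailFun M r y := by
  rw [tailFun_eq_one_add hM hy]
  have : 0 ≤ ∫ t in (0 : ℝ)..y, (tailFun M r t - tailFun M r (t - M)) := by
    rw [intervalIntegral.integral_of_le hy.le]
    exact setIntegral_nonneg measurableSet_Ioc fun t ht => (tailFun_diff_pos hM hr ht.1).le
  nlinarith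

theorem tailFun_nonneg (hM : 0 < M) (hr : 0 < r) (y : ℝ) : 0 ≤ tailFun M r y := by
  rcases le_or_gt y 0 with h | h
  · rw [tailFun_of_nonpos hM h]
  · exact zero_le_one.trans (one_le_tailFun hM hr h)

theorem integral_tailFun_diff (hM : 0 < M) {x y : ℝ} (hx : 0 < x) (hy : 0 < y) :
    r * ∫ t in x..y, (tailFun M r t - tailFun M r (t - M)) = tailFun M r y - tailFun M r x := by
  have h := fun a b => intervalIntegrable_tailFun_diff (r := r) hM a b
  rw [tailFun_eq_one_add hM hy, tailFun_eq_one_add hM hx,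
    ← intervalIntegral.integral_add_adjacent_intervals (h 0 x) (h x y)]
  ring

theorem monotone_tailFun (hM : 0 < M) (hr : 0 < r) : Monotone (tailFun M r) := by
  intro x y hxy
  rcases le_or_gt x 0 with h | h
  · rw [tailFun_of_nonpos hM h]
    exact tailFun_nonneg hM hr y
  · have h1 := integral_tailFun_diff (r := r) hM h (h.trans_le hxy)
    have : 0 ≤ ∫ t in x..y, (tailFun M r t - tailFun M r (t - M)) := by
      rw [intervalIntegral.integral_of_le hxy]
      exact setIntegral_nonneg measurableSet_Ioc
        fun t ht => (tailFun_diff_pos hM hr (h.trans ht.1)).le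
    nlinarith

theorem tailFun_diff_nonneg (hM : 0 < M) (hr : 0 < r) (y : ℝ) :
    0 ≤ tailFun M r y - tailFun M r (y - M) :=
  sub_nonneg.2 (monotone_tailFun hM hr (by linarith))

/-! ### The explicit expressions in terms of the tail function -/

theorem tailFun_diff_eq_sum (hM : 0 < M) {y : ℝ} {n : ℕ} (h1 : n * M < y) (h2 : y ≤ (n + 1) * M) :
    tailFun M r y - tailFun M r (y - M) = Real.exp (r * y) *
      (1 + ∑ q ∈ Finset.Icc 1 n,
        Real.exp (-(r * M) * q) / ((q - 1).factorial : ℝ) *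
          (r * M * q - r * y) ^ (q - 1) * (-(r * y) / q + r * M - 1)) := by
  have e1 : ⌈y / M⌉₊ = n + 1 := by
    rw [Nat.ceil_eq_iff (by simp)]
    push_cast
    refine ⟨?_, (div_le_iff₀ hM).2 h2⟩
    exact (lt_div_iff₀ hM).2 h1
  have e2 : ⌈(y - M) / M⌉₊ = n := by
    rw [sub_div, div_self hM.ne', Nat.ceil_sub_one, e1, Nat.add_sub_cancel]
  have e3 : Finset.Icc 1 n = Finset.Ico (0 + 1) (n + 1) := by
    ext q; simp only [Finset.mem_Icc, Finset.mem_Ico]; omega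
  rw [tailFun, tailFun, e1, e2, Finset.sum_range_succ', add_sub_right_comm,
    ← Finset.sum_sub_distrib, mul_add, mul_one, add_comm, e3, ← Finset.sum_Ico_add',
    ← Finset.range_eq_Ico, Finset.mul_sum]
  congr 1
  · simp [tailPoly]
  refine Finset.sum_congr rfl fun q _ => ?_
  have e4 : Real.exp (r * (y - ((q + 1 : ℕ) : ℝ) * M)) =
      Real.exp (r * y) * Real.exp (-(r * M) * ((q + 1 : ℕ) : ℝ)) := by
    rw [← Real.exp_add]; ring_nf
  have e5 : r * (y - M - (q : ℝ) * M) = r * (y - ((q + 1 : ℕ) : ℝ) * M) := by push_cast; ring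
  have e6 : r * ((q : ℝ) * M - (y - M)) = r * M * ((q + 1 : ℕ) : ℝ) - r * y := by push_cast; ring
  have e7 : r * (((q + 1 : ℕ) : ℝ) * M - y) = r * M * ((q + 1 : ℕ) : ℝ) - r * y := by ring
  simp only [tailPoly, e5, e6, e7, e4, Nat.add_sub_cancel]
  have e8 : (((q + 1).factorial : ℕ) : ℝ) = ((q : ℝ) + 1) * (q.factorial : ℝ) := by
    rw [Nat.factorial_succ]; push_cast; ring
  have h4 : (q.factorial : ℝ) ≠ 0 := by positivity
  have h5 : (q : ℝ) + 1 ≠ 0 := by positivity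
  rw [e8, pow_succ]
  generalize Real.exp (-(r * M) * ((q + 1 : ℕ) : ℝ)) = E
  generalize hA : (r * M * ((q + 1 : ℕ) : ℝ) - r * y) ^ q = A
  push_cast
  field_simp
  ring

theorem sectionExpr_eq (hM : 0 < M) {l n : ℕ} {x : ℝ} (h1 : n * M < l * M - x)
    (h2 : l * M - x ≤ (n + 1) * M) :
    sectionExpr M r l n x = tailFun M r (l * M - x) - tailFun M r (l * M - x - M) := by
  rw [tailFun_diff_eq_sum hM h1 h2, sectionExpr]
  have e1 : -r * (x - l * M) = r * (l * M - x) := by ring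
  rw [e1]
  congr 2
  refine Finset.sum_congr rfl fun q _ => ?_
  ring

/-- The section index used in `approxPdf` is the right one. -/
theorem sectionExpr_ceil_eq (hM : 0 < M) {l : ℕ} {x : ℝ} (hx : x < l * M) :
    sectionExpr M r l (⌈(l * M - x) / M⌉₊ - 1) x =
      tailFun M r (l * M - x) - tailFun M r (l * M - x - M) := by
  have hpos : 0 < (l * M - x) / M := div_pos (by linarith) hM
  obtain ⟨n, hn⟩ : ∃ n, ⌈(l * M - x) / M⌉₊ = n + 1 :=
    Nat.exists_eq_succ_of_ne_zero (Nat.ceil_pos.2 hpos).ne'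
  have h := (Nat.ceil_eq_iff (by simp)).1 hn
  push_cast at h
  rw [hn, Nat.add_sub_cancel]
  exact sectionExpr_eq hM ((lt_div_iff₀ hM).1 h.1) ((div_le_iff₀ hM).1 h.2)

theorem sigma1_eq (hM : 0 < M) {l : ℕ} (hl : 1 ≤ l) :
    sigma1 M r l = tailFun M r (l * M) - tailFun M r (l * M - M) := by
  obtain ⟨n, rfl⟩ : ∃ n, l = n + 1 := ⟨l - 1, by omega⟩
  rw [tailFun_diff_eq_sum (n := n) hM (by push_cast; nlinarith) (by push_cast; linarith), sigma1,
    Nat.add_sub_cancel]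

/-- The double sum in the normalisation of the approximate law telescopes. -/
theorem one_add_sum_eq (hM : 0 < M) (nc : ℕ) :
    1 + ∑ n ∈ Finset.range nc, Real.exp (n * (r * M)) *
      ∑ q ∈ Finset.range (n + 1),
        (r * M * Real.exp (-(r * M))) ^ q / (q.factorial : ℝ) *
          (Real.exp (r * M) * ((q : ℝ) - (n + 1)) ^ q - ((q : ℝ) - n) ^ q) =
      if nc = 0 then 1 else tailFun M r (nc * M) := by
  have hterm : ∀ n q : ℕ, Real.exp (n * (r * M)) *
      ((r * M * Real.exp (-(r * M))) ^ q / (q.factorial : ℝ) * ((q : ℝ) - n) ^ q) =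
      tailPoly M r q (n * M) := by
    intro n q
    have e1 : r * ((q : ℝ) * M - n * M) = r * M * ((q : ℝ) - n) := by ring
    have e2 : Real.exp (r * ((n : ℝ) * M - q * M)) =
        Real.exp (n * (r * M)) * Real.exp (-(r * M)) ^ q := by
      rw [← Real.exp_nat_mul, ← Real.exp_add]; ring_nf
    rw [tailPoly, e1, e2, mul_pow (r * M) ((q : ℝ) - n), mul_pow (r * M) (Real.exp _)]
    ring
  have hT : ∀ n : ℕ, tailFun M r (n * M) = ∑ q ∈ Finset.range n, tailPoly M r q (n * M) := by
    intro n
    rw [tailFun, mul_div_cancel_right₀ _ hM.ne', Nat.ceil_natCast]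
  have hstep : ∀ n : ℕ, Real.exp (n * (r * M)) *
      ∑ q ∈ Finset.range (n + 1),
        (r * M * Real.exp (-(r * M))) ^ q / (q.factorial : ℝ) *
          (Real.exp (r * M) * ((q : ℝ) - (n + 1)) ^ q - ((q : ℝ) - n) ^ q) =
      tailFun M r ((n + 1 : ℕ) * M) - (if n = 0 then 1 else tailFun M r (n * M)) := by
    intro n
    have h1 : (if n = 0 then 1 else tailFun M r (n * M)) =
        ∑ q ∈ Finset.range (n + 1), tailPoly M r q (n * M) := by
      rcases Nat.eq_zero_or_pos n with rfl | hn
      · simp [tailPoly]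
      · rw [if_neg hn.ne', Finset.sum_range_succ, hT]
        simp [tailPoly, hn.ne']
    rw [h1, hT, Finset.mul_sum, ← Finset.sum_sub_distrib]
    refine Finset.sum_congr rfl fun q _ => ?_
    rw [← hterm, ← hterm]
    have : Real.exp (((n + 1 : ℕ) : ℝ) * (r * M)) = Real.exp (n * (r * M)) * Real.exp (r * M) := by
      rw [← Real.exp_add]; push_cast; ring_nf
    rw [this]
    push_cast
    ring
  induction nc with
  | zero => simp
  | succ n ih =>
    rw [Finset.sum_range_succ, ← add_assoc, ih, hstep]
    simp

/-! ### The exact stationary law -/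

/-- The stationary probability of a full buffer of size `K`. -/
noncomputable def exactAtom (M lam K : ℝ) : ℝ :=
  (1 + lam * M * tailFun M lam (K - M))⁻¹

/-- The stationary density for buffer size `K ≥ 2 * M`. It expresses the level crossing balance: the
density at `x` is `lam` times the stationary mass of `(max x M, x + M]`, the set of levels above `x`
from which the removal of `M` leads to at most `x`. -/
noncomputable def exactPdf (M lam K x : ℝ) : ℝ :=
  exactAtom M lam K * lam * (tailFun M lam (K - max x M) - tailFun M lam (K - M - x))

/-- The law on `[0, K]` with density `g` and an atom `a` at `K`. -/
noncomputable def bufferLaw (K : ℝ) (g : ℝ → ℝ) (a : ℝ) : Measure ℝ :=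
  (volume.restrict (Ioo 0 K)).withDensity (fun x => ENNReal.ofReal (g x)) +
    ENNReal.ofReal a • Measure.dirac K

theorem exactAtom_pos (hM : 0 < M) (hlam : 0 < lam) : 0 < exactAtom M lam K := by
  have := tailFun_nonneg hM hlam (K - M)
  unfold exactAtom; positivity

theorem exactPdf_nonneg (hM : 0 < M) (hlam : 0 < lam) {x : ℝ} (hx : 0 ≤ x) :
    0 ≤ exactPdf M lam K x := by
  have h := monotone_tailFun hM hlam (a := K - M - x) (b := K - max x M) (by
    rcases max_cases x M with ⟨h, _⟩ | ⟨h, _⟩ <;> rw [h] <;> linarith)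
  have := exactAtom_pos (K := K) hM hlam
  unfold exactPdf
  have := sub_nonneg.2 h
  positivity

theorem measurable_tailFun (hM : 0 < M) (hlam : 0 < lam) : Measurable (tailFun M lam) :=
  (monotone_tailFun hM hlam).measurable

theorem measurable_exactPdf (hM : 0 < M) (hlam : 0 < lam) : Measurable (exactPdf M lam K) := by
  have := measurable_tailFun hM hlam
  unfold exactPdf; fun_prop

theorem continuousWithinAt_exactPdf (hM : 0 < M) (x : ℝ) :
    ContinuousWithinAt (exactPdf M lam K) (Ici x) x := by
  unfold exactPdf
  refine ContinuousWithinAt.mul continuousWithinAt_const (ContinuousWithinAt.sub ?_ ?_)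
  · refine ContinuousWithinAt.comp (g := tailFun M lam) (t := Iic (K - max x M))
      (continuousWithinAt_tailFun hM _) (by fun_prop) fun y hy => ?_
    exact sub_le_sub_left (max_le_max_right M hy) K
  · refine ContinuousWithinAt.comp (g := tailFun M lam) (t := Iic (K - M - x))
      (continuousWithinAt_tailFun hM _) (by fun_prop) fun y hy => ?_
    exact sub_le_sub_left hy (K - M)

theorem intervalIntegrable_exactPdf (hM : 0 < M) (hlam : 0 < lam) (a b : ℝ) :
    IntervalIntegrable (exactPdf M lam K) volume a b := by
  have h1 : AntitoneOn (fun x => tailFun M lam (K - max x M)) (uIcc a b) :=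
    fun x _ y _ h => monotone_tailFun hM hlam (sub_le_sub_left (max_le_max_right M h) K)
  have h2 : AntitoneOn (fun x => tailFun M lam (K - M - x)) (uIcc a b) :=
    fun x _ y _ h => monotone_tailFun hM hlam (sub_le_sub_left h _)
  exact (h1.intervalIntegrable.sub h2.intervalIntegrable).const_mul _

theorem exactPdf_of_le {x : ℝ} (hx : x ≤ M) : exactPdf M lam K x =
    exactAtom M lam K * lam * (tailFun M lam (K - M) - tailFun M lam (K - M - x)) := by
  rw [exactPdf, max_eq_right hx]

theorem exactPdf_of_ge {x : ℝ} (hx : M ≤ x) : exactPdf M lam K x =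
    exactAtom M lam K * lam * (tailFun M lam (K - x) - tailFun M lam (K - x - M)) := by
  rw [exactPdf, max_eq_left hx, sub_right_comm]

theorem integral_exactPdf_right (hM : 0 < M) {x : ℝ} (hx : M ≤ x) (hxK : x < K) :
    ∫ t in x..K, exactPdf M lam K t = exactAtom M lam K * (tailFun M lam (K - x) - 1) := by
  have h1 : ∫ t in x..K, exactPdf M lam K t = ∫ t in x..K, exactAtom M lam K * lam *
      (tailFun M lam (K - t) - tailFun M lam (K - t - M)) := by
    refine intervalIntegral.integral_congr_uIoo fun t ht => ?_
    rw [uIoo_of_le hxK.le] at ht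
    exact exactPdf_of_ge (hx.trans ht.1.le)
  have h2 := intervalIntegral.integral_comp_sub_left (a := x) (b := K)
    (fun t => tailFun M lam t - tailFun M lam (t - M)) K
  rw [h1, intervalIntegral.integral_const_mul, h2, sub_self,
    tailFun_eq_one_add (y := K - x) hM (by linarith)]
  ring

/-- The total mass is `1`, by the window identity for `tailFun` at `K - M`. -/
theorem integral_exactPdf (hM : 0 < M) (hlam : 0 < lam) (hK : 2 * M ≤ K) :
    ∫ t in (0 : ℝ)..K, exactPdf M lam K t = 1 - exactAtom M lam K := by
  have h1 : ∫ t in (0 : ℝ)..M, exactPdf M lam K t = ∫ t in (0 : ℝ)..M, exactAtom M lam K * lam *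
      (tailFun M lam (K - M) - tailFun M lam (K - M - t)) := by
    refine intervalIntegral.integral_congr_uIoo fun t ht => ?_
    rw [uIoo_of_le hM.le] at ht
    exact exactPdf_of_le ht.2.le
  have h2 : ∫ t in (0 : ℝ)..M, tailFun M lam (K - M - t) =
      ∫ t in (K - M - M)..(K - M), tailFun M lam t := by
    simp
  have h3 : IntervalIntegrable (fun t => tailFun M lam (K - M - t)) volume 0 M := by
    have := (intervalIntegrable_tailFun (r := lam) hM (K - M - 0) (K - M - M)).comp_sub_left (K - M)
    simpa using this
  have h4 := tailFun_eq_window (r := lam) (y := K - M) hM (by linarith)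
  have h5 : exactAtom M lam K * (1 + lam * M * tailFun M lam (K - M)) = 1 := by
    have := tailFun_nonneg hM hlam (K - M)
    exact inv_mul_cancel₀ (by positivity)
  rw [← intervalIntegral.integral_add_adjacent_intervals
    (intervalIntegrable_exactPdf hM hlam 0 M) (intervalIntegrable_exactPdf hM hlam M K),
    integral_exactPdf_right hM le_rfl (by linarith), h1, intervalIntegral.integral_const_mul,
    intervalIntegral.integral_sub intervalIntegrable_const h3, h2, intervalIntegral.integral_const,
    smul_eq_mul]
  linear_combination h5 + exactAtom M lam K * h4

section BufferLaw

variable {g : ℝ → ℝ} {a : ℝ}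

theorem bufferLaw_apply (K : ℝ) (g : ℝ → ℝ) (a : ℝ) {A : Set ℝ} (hA : MeasurableSet A) :
    bufferLaw K g a A = (∫⁻ x in A ∩ Ioo 0 K, ENNReal.ofReal (g x)) +
      ENNReal.ofReal a * A.indicator 1 K := by
  rw [bufferLaw, Measure.add_apply, withDensity_apply _ hA, Measure.restrict_restrict hA,
    Measure.smul_apply, Measure.dirac_apply' _ hA, smul_eq_mul]

theorem lintegral_Ioo_ofReal {s t : ℝ} (hst : s ≤ t) (hi : IntervalIntegrable g volume s t)
    (hg : ∀ x ∈ Ioo s t, 0 ≤ g x) :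
    ∫⁻ x in Ioo s t, ENNReal.ofReal (g x) = ENNReal.ofReal (∫ x in s..t, g x) := by
  rw [intervalIntegral.integral_of_le hst, integral_Ioc_eq_integral_Ioo,
    ofReal_integral_eq_lintegral_ofReal]
  · exact ((intervalIntegrable_iff_integrableOn_Ioc_of_le hst).1 hi).mono_set Ioo_subset_Ioc_self
  · exact (ae_restrict_iff' measurableSet_Ioo).2 (ae_of_all _ hg)

/-- The distribution function of `bufferLaw` below `K`. -/
theorem bufferLaw_Iic (hi : ∀ s t, IntervalIntegrable g volume s t) (hg : ∀ x, 0 ≤ x → 0 ≤ g x)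
    {t : ℝ} (ht : 0 ≤ t) (htK : t < K) :
    bufferLaw K g a (Iic t) = ENNReal.ofReal (∫ x in (0 : ℝ)..t, g x) := by
  have h1 : Iic t ∩ Ioo 0 K = Ioc 0 t := by
    ext x; simp only [mem_inter_iff, mem_Iic, mem_Ioo, mem_Ioc]
    exact ⟨fun h => ⟨h.2.1, h.1⟩, fun h => ⟨h.2, h.1, h.2.trans_lt htK⟩⟩
  rw [bufferLaw_apply _ _ _ measurableSet_Iic, h1, indicator_of_notMem (by simpa using htK),
    mul_zero, add_zero, setLIntegral_congr Ioo_ae_eq_Ioc.symm,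
    lintegral_Ioo_ofReal ht (hi _ _) fun x hx => hg x hx.1.le]

theorem bufferLaw_Ioi (hi : ∀ s t, IntervalIntegrable g volume s t) (hg : ∀ x, 0 ≤ x → 0 ≤ g x)
    {t : ℝ} (ht : 0 ≤ t) (htK : t < K) (ha : 0 ≤ a) :
    bufferLaw K g a (Ioi t) = ENNReal.ofReal ((∫ x in t..K, g x) + a) := by
  have h1 : Ioi t ∩ Ioo 0 K = Ioo t K := by
    ext x; simp only [mem_inter_iff, mem_Ioi, mem_Ioo]
    exact ⟨fun h => ⟨h.1, h.2.2⟩, fun h => ⟨h.1, ht.trans_lt h.1, h.2⟩⟩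
  have h2 : 0 ≤ ∫ x in t..K, g x :=
    intervalIntegral.integral_nonneg htK.le fun x hx => hg x (ht.trans hx.1)
  rw [bufferLaw_apply _ _ _ measurableSet_Ioi, h1, indicator_of_mem (by simpa using htK),
    Pi.one_apply, mul_one, lintegral_Ioo_ofReal htK.le (hi _ _)
    fun x hx => hg x (ht.trans hx.1.le), ENNReal.ofReal_add h2 ha]

theorem bufferLaw_Ioi_of_ge {t : ℝ} (htK : K ≤ t) : bufferLaw K g a (Ioi t) = 0 := by
  have h1 : Ioi t ∩ Ioo 0 K = ∅ := by
    ext x; simp only [mem_inter_iff, mem_Ioi, mem_Ioo, mem_empty_iff_false, iff_false]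
    intro h; linarith [h.1, h.2.2]
  rw [bufferLaw_apply _ _ _ measurableSet_Ioi, h1, indicator_of_notMem (by simpa using htK)]
  simp

theorem bufferLaw_compl_Icc (hK : 0 ≤ K) : bufferLaw K g a (Icc 0 K)ᶜ = 0 := by
  have h1 : (Icc 0 K)ᶜ ∩ Ioo 0 K = ∅ := by
    ext x; simp only [mem_inter_iff, mem_compl_iff, mem_empty_iff_false, iff_false]
    exact fun h => h.1 ⟨h.2.1.le, h.2.2.le⟩
  rw [bufferLaw_apply _ _ _ measurableSet_Icc.compl, h1, indicator_of_notMem (by simpa using hK)]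
  simp

theorem bufferLaw_univ (hi : ∀ s t, IntervalIntegrable g volume s t) (hg : ∀ x, 0 ≤ x → 0 ≤ g x)
    (hK : 0 ≤ K) (ha : 0 ≤ a) :
    bufferLaw K g a univ = ENNReal.ofReal ((∫ x in (0 : ℝ)..K, g x) + a) := by
  have h2 : 0 ≤ ∫ x in (0 : ℝ)..K, g x :=
    intervalIntegral.integral_nonneg hK fun x hx => hg x hx.1
  rw [bufferLaw_apply _ _ _ MeasurableSet.univ, univ_inter, indicator_univ, Pi.one_apply, mul_one,
    lintegral_Ioo_ofReal hK (hi _ _) fun x hx => hg x hx.1.le, ENNReal.ofReal_add h2 ha]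

end BufferLaw

/-- The stationary law. -/
noncomputable def exactLaw (M lam K : ℝ) : Measure ℝ :=
  bufferLaw K (exactPdf M lam K) (exactAtom M lam K)

theorem exactLaw_Iic (hM : 0 < M) (hlam : 0 < lam) {t : ℝ} (ht : 0 ≤ t) (htK : t < K) :
    exactLaw M lam K (Iic t) = ENNReal.ofReal (∫ x in (0 : ℝ)..t, exactPdf M lam K x) :=
  bufferLaw_Iic (intervalIntegrable_exactPdf hM hlam) (fun _ hx => exactPdf_nonneg hM hlam hx)
    ht htK

theorem exactLaw_Ioi (hM : 0 < M) (hlam : 0 < lam) {t : ℝ} (ht : M ≤ t) :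
    exactLaw M lam K (Ioi t) = ENNReal.ofReal (exactAtom M lam K * tailFun M lam (K - t)) := by
  rcases lt_or_ge t K with h | h
  · rw [exactLaw, bufferLaw_Ioi (intervalIntegrable_exactPdf hM hlam)
      (fun _ hx => exactPdf_nonneg hM hlam hx) (hM.le.trans ht) h (exactAtom_pos hM hlam).le,
      integral_exactPdf_right hM ht h]
    congr 1; ring
  · rw [exactLaw, bufferLaw_Ioi_of_ge h, tailFun_of_nonpos hM (by linarith), mul_zero,
      ENNReal.ofReal_zero]

theorem exactLaw_Ioc (hM : 0 < M) (hlam : 0 < lam) {s t : ℝ} (hs : M ≤ s) (hst : s ≤ t) :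
    exactLaw M lam K (Ioc s t) =
      ENNReal.ofReal (exactAtom M lam K * (tailFun M lam (K - s) - tailFun M lam (K - t))) := by
  have h : Ioc s t = Ioi s \ Ioi t := by
    ext x; simp only [mem_Ioc, Set.mem_sdiff, mem_Ioi, not_lt]
  have ha := (exactAtom_pos (K := K) hM hlam).le
  rw [h, measure_sdiff (Ioi_subset_Ioi hst) measurableSet_Ioi.nullMeasurableSet
    (by rw [exactLaw_Ioi hM hlam (hs.trans hst)]; exact ENNReal.ofReal_ne_top),
    exactLaw_Ioi hM hlam hs, exactLaw_Ioi hM hlam (hs.trans hst),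
    ← ENNReal.ofReal_sub _ (mul_nonneg ha (tailFun_nonneg hM hlam _)), mul_sub]

theorem isProbabilityMeasure_exactLaw (hM : 0 < M) (hlam : 0 < lam) (hK : 2 * M ≤ K) :
    IsProbabilityMeasure (exactLaw M lam K) := by
  constructor
  rw [exactLaw, bufferLaw_univ (intervalIntegrable_exactPdf hM hlam)
    (fun _ hx => exactPdf_nonneg hM hlam hx) (by linarith) (exactAtom_pos hM hlam).le,
    integral_exactPdf hM hlam hK, sub_add_cancel, ENNReal.ofReal_one]

/-- The distribution function, under the stationary law, of the content left after the possible
removal of `M`. -/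
theorem exactLaw_setOf_sub_le (hM : 0 < M) (hlam : 0 < lam) {t : ℝ} (ht : 0 ≤ t)
    (htK : t < K) :
    exactLaw M lam K {u | u - (if M < u then M else 0) ≤ t} =
      ENNReal.ofReal ((∫ x in (0 : ℝ)..t, exactPdf M lam K x) + exactPdf M lam K t / lam) := by
  have hset : {u : ℝ | u - (if M < u then M else 0) ≤ t} = Iic t ∪ Ioc (max t M) (t + M) := by
    ext u
    simp only [mem_ofPred_eq, mem_union, mem_Iic, mem_Ioc, max_lt_iff]
    split_ifs with h
    · constructor
      · intro hu
        rcases le_or_gt u t with h1 | h1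
        · exact Or.inl h1
        · exact Or.inr ⟨⟨h1, h⟩, by linarith⟩
      · rintro (h1 | h1) <;> linarith [h1]
    · constructor
      · intro hu; exact Or.inl (by linarith)
      · rintro (h1 | h1)
        · linarith
        · exact absurd h1.1.2 h
  have hdisj : Disjoint (Iic t) (Ioc (max t M) (t + M)) :=
    disjoint_left.2 fun u hu hu2 => absurd (lt_of_le_of_lt (le_max_left t M) hu2.1) (not_lt.2 hu)
  have hmax : max t M ≤ t + M := max_le (by linarith) (by linarith)
  have hg : exactAtom M lam K * (tailFun M lam (K - max t M) - tailFun M lam (K - (t + M))) =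
      exactPdf M lam K t / lam := by
    rw [exactPdf, show K - (t + M) = K - M - t by ring]
    field_simp
  rw [hset, measure_union hdisj measurableSet_Ioc, exactLaw_Iic hM hlam ht htK,
    exactLaw_Ioc hM hlam (le_max_right t M) hmax, hg, ENNReal.ofReal_add]
  · exact intervalIntegral.integral_nonneg ht fun x hx => exactPdf_nonneg hM hlam hx.1
  · exact div_nonneg (exactPdf_nonneg hM hlam ht) hlam.le

/-- Convolving with the exponential distribution undoes the operator `F ↦ F + F' / lam`. -/
theorem integral_exp_conv_exactPdf (hM : 0 < M) (hlam : 0 < lam) {x : ℝ} (hx : 0 ≤ x) :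
    ∫ s in (0 : ℝ)..x, lam * Real.exp (-(lam * s)) *
        ((∫ t in (0 : ℝ)..(x - s), exactPdf M lam K t) + exactPdf M lam K (x - s) / lam) =
      ∫ t in (0 : ℝ)..x, exactPdf M lam K t := by
  set g := exactPdf M lam K with hg
  have hi : ∀ a b, IntervalIntegrable g volume a b := intervalIntegrable_exactPdf hM hlam
  set F : ℝ → ℝ := fun t => ∫ u in (0 : ℝ)..t, g u with hF
  have hFc : Continuous F := intervalIntegral.continuous_primitive hi 0
  have hFd : ∀ t, HasDerivWithinAt F (g t) (Ioi t) t := fun t =>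
    (intervalIntegral.integral_hasDerivWithinAt_right (s := Ici t) (t := Ioi t) (hi 0 t)
      (measurable_exactPdf hM hlam).stronglyMeasurable.stronglyMeasurableAtFilter
      ((continuousWithinAt_exactPdf hM t).mono Ioi_subset_Ici_self)).mono Ioi_subset_Ici_self
  have hd : ∀ t ∈ Ioo (0 : ℝ) x, HasDerivWithinAt (fun t => Real.exp (lam * t) * F t)
      (Real.exp (lam * t) * (lam * F t + g t)) (Ioi t) t := by
    intro t _
    have h1 : HasDerivAt (fun t => Real.exp (lam * t)) (Real.exp (lam * t) * (lam * 1)) t :=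
      ((hasDerivAt_id t).const_mul lam).exp
    exact (h1.hasDerivWithinAt.mul (hFd t)).congr_deriv (by ring)
  have hint : IntervalIntegrable (fun t => Real.exp (lam * t) * (lam * F t + g t)) volume 0 x :=
    (((hFc.const_mul lam).intervalIntegrable 0 x).add (hi 0 x)).continuousOn_mul
      (by fun_prop)
  have key := intervalIntegral.integral_eq_sub_of_hasDeriv_right_of_le hx
    (f := fun t => Real.exp (lam * t) * F t) (by fun_prop) hd hint
  have hsub := intervalIntegral.integral_comp_sub_left (a := 0) (b := x)
    (fun t => lam * Real.exp (-(lam * (x - t))) * (F t + g t / lam)) x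
  simp only [sub_sub_cancel, sub_self, sub_zero] at hsub
  rw [hsub]
  have hcongr : ∀ t, lam * Real.exp (-(lam * (x - t))) * (F t + g t / lam) =
      Real.exp (-(lam * x)) * (Real.exp (lam * t) * (lam * F t + g t)) := by
    intro t
    have : Real.exp (-(lam * (x - t))) = Real.exp (-(lam * x)) * Real.exp (lam * t) := by
      rw [← Real.exp_add]; ring_nf
    rw [this]
    field_simp
  simp_rw [hcongr]
  rw [intervalIntegral.integral_const_mul, key]
  have h0 : F 0 = 0 := intervalIntegral.integral_same
  simp only [h0, mul_zero, sub_zero]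
  rw [← mul_assoc, ← Real.exp_add]
  simp [hF]

theorem measurable_storageStep (M K : ℝ) : Measurable fun z : ℝ × ℝ => storageStep M K z.1 z.2 := by
  unfold storageStep
  refine Measurable.min ((measurable_fst.sub (Measurable.ite ?_ measurable_const
    measurable_const)).add measurable_snd) measurable_const
  exact measurableSet_lt measurable_const measurable_fst

theorem ae_expMeasure_nonneg (lam : ℝ) : ∀ᵐ s ∂ProbabilityTheory.expMeasure lam, 0 ≤ s := by
  rw [ProbabilityTheory.expMeasure, ProbabilityTheory.gammaMeasure, ae_iff]
  simp only [not_le]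
  rw [show {a : ℝ | a < 0} = Iio 0 from rfl, withDensity_apply _ measurableSet_Iio]
  exact ProbabilityTheory.lintegral_gammaPDF_of_nonpos le_rfl

/-- The expectation of a function of the arrival that vanishes beyond `x`; no measurability of `f` is
needed. -/
theorem lintegral_expMeasure {f : ℝ → ENNReal} {x : ℝ}
    (hf : ∀ s, x < s → f s = 0) :
    ∫⁻ s, f s ∂ProbabilityTheory.expMeasure lam =
      ∫⁻ s in Icc 0 x, ENNReal.ofReal (lam * Real.exp (-(lam * s))) * f s := by
  have hm : Measurable (ProbabilityTheory.gammaPDF 1 lam) :=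
    (ProbabilityTheory.measurable_gammaPDFReal 1 lam).ennreal_ofReal
  rw [ProbabilityTheory.expMeasure, ProbabilityTheory.gammaMeasure,
    lintegral_withDensity_eq_lintegral_mul_non_measurable₀ _ hm.aemeasurable
      (ae_of_all _ fun s => ENNReal.ofReal_lt_top), ← lintegral_indicator measurableSet_Icc]
  refine lintegral_congr fun s => ?_
  rw [Pi.mul_apply]
  change ProbabilityTheory.exponentialPDF lam s * f s = _
  by_cases hs : s ∈ Icc 0 x
  · rw [indicator_of_mem hs, ProbabilityTheory.exponentialPDF_of_nonneg hs.1]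
  · rw [indicator_of_notMem hs]
    rcases lt_or_ge s 0 with h | h
    · rw [ProbabilityTheory.exponentialPDF_of_neg h, zero_mul]
    · rw [hf s (not_le.1 fun h2 => hs ⟨h, h2⟩), mul_zero]

theorem isProbabilityMeasure_nextLaw (hlam : 0 < lam) (μ : Measure ℝ) [IsProbabilityMeasure μ] :
    IsProbabilityMeasure (nextLaw M lam K μ) := by
  have := ProbabilityTheory.isProbabilityMeasure_expMeasure hlam
  exact Measure.isProbabilityMeasure_map (measurable_storageStep M K).aemeasurable

theorem nextLaw_Iic (hlam : 0 < lam) (μ : Measure ℝ) [IsProbabilityMeasure μ] {x : ℝ} (hx : x < K) :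
    nextLaw M lam K μ (Iic x) =
      ∫⁻ s, μ {u | u - (if M < u then M else 0) ≤ x - s} ∂ProbabilityTheory.expMeasure lam := by
  have := ProbabilityTheory.isProbabilityMeasure_expMeasure hlam
  rw [nextLaw, Measure.map_apply (measurable_storageStep M K) measurableSet_Iic,
    Measure.prod_apply_symm (measurable_storageStep M K measurableSet_Iic)]
  refine lintegral_congr fun s => congrArg μ ?_
  ext u
  simp only [mem_preimage, storageStep, mem_Iic, min_le_iff, mem_ofPred_eq, not_le.2 hx, or_false]
  exact le_sub_iff_add_le.symm

theorem measure_setOf_sub_le_of_neg {μ : Measure ℝ} (hμ : μ (Icc 0 K)ᶜ = 0) {t : ℝ}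
    (ht : t < 0) : μ {u | u - (if M < u then M else 0) ≤ t} = 0 := by
  refine measure_mono_null (t := (Icc 0 K)ᶜ) (fun u hu => ?_) hμ
  rw [mem_compl_iff]
  intro h
  simp only [mem_ofPred_eq] at hu
  split_ifs at hu <;> linarith [h.1]

theorem exactLaw_compl_Icc (hK : 0 ≤ K) : exactLaw M lam K (Icc 0 K)ᶜ = 0 :=
  bufferLaw_compl_Icc hK

theorem nextLaw_compl_Icc (hlam : 0 < lam) (hK : 0 ≤ K) {μ : Measure ℝ}
    [IsProbabilityMeasure μ] (hμ : μ (Icc 0 K)ᶜ = 0) : nextLaw M lam K μ (Icc 0 K)ᶜ = 0 := by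
  have := ProbabilityTheory.isProbabilityMeasure_expMeasure hlam
  rw [nextLaw, Measure.map_apply (measurable_storageStep M K) measurableSet_Icc.compl,
    Measure.prod_apply_symm (measurable_storageStep M K measurableSet_Icc.compl),
    lintegral_eq_zero_iff' (Measurable.aemeasurable (measurable_measure_prodMk_right
      (measurable_storageStep M K measurableSet_Icc.compl)))]
  filter_upwards [ae_expMeasure_nonneg lam] with s hs
  refine measure_mono_null (t := (Icc 0 K)ᶜ) (fun u hu => ?_) hμ
  rw [mem_compl_iff]
  intro h
  refine absurd ?_ ((mem_compl_iff _ _).1 (mem_preimage.1 (mem_preimage.1 hu)))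
  simp only [storageStep, mem_Icc, min_le_iff, le_min_iff, le_refl, or_true, and_true]
  refine ⟨?_, hK⟩
  split_ifs <;> linarith [h.1]

/-- The explicit law is stationary: the distribution functions before and after a step agree. -/
theorem nextLaw_exactLaw (hM : 0 < M) (hlam : 0 < lam) (hK : 2 * M ≤ K) :
    nextLaw M lam K (exactLaw M lam K) = exactLaw M lam K := by
  have hK0 : 0 ≤ K := by linarith
  have := isProbabilityMeasure_exactLaw hM hlam hK
  have := isProbabilityMeasure_nextLaw (M := M) (K := K) hlam (exactLaw M lam K)
  have hsupp := exactLaw_compl_Icc (M := M) (lam := lam) hK0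
  have hnext := nextLaw_compl_Icc (M := M) hlam hK0 hsupp
  have hlow : ∀ x < 0, (Iic x : Set ℝ) ⊆ (Icc 0 K)ᶜ := fun x hx u hu h =>
    absurd (h.1.trans hu) (not_le.2 hx)
  have hhigh : ∀ x, K ≤ x → (Iic x : Set ℝ)ᶜ ⊆ (Icc 0 K)ᶜ := fun x hx =>
    compl_subset_compl.2 fun u hu => hu.2.trans hx
  refine Measure.ext_of_Iic _ _ fun x => ?_
  rcases lt_or_ge x 0 with hx0 | hx0
  · rw [measure_mono_null (hlow x hx0) hsupp, measure_mono_null (hlow x hx0) hnext]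
  rcases lt_or_ge x K with hxK | hxK
  · have h1 : ∀ s ∈ Icc 0 x, ENNReal.ofReal (lam * Real.exp (-(lam * s))) *
        exactLaw M lam K {u | u - (if M < u then M else 0) ≤ x - s} =
        ENNReal.ofReal (lam * Real.exp (-(lam * s)) *
          ((∫ t in (0 : ℝ)..(x - s), exactPdf M lam K t) + exactPdf M lam K (x - s) / lam)) := by
      intro s hs
      rw [exactLaw_setOf_sub_le hM hlam (by linarith [hs.2]) (by linarith [hs.1]),
        ← ENNReal.ofReal_mul (by positivity)]
    rw [nextLaw_Iic hlam _ hxK, lintegral_expMeasure (x := x) fun s hs =>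
        measure_setOf_sub_le_of_neg hsupp (by linarith),
      setLIntegral_congr_fun measurableSet_Icc h1, exactLaw_Iic hM hlam hx0 hxK,
      ← integral_exp_conv_exactPdf hM hlam hx0, setLIntegral_congr Ioo_ae_eq_Icc.symm,
      lintegral_Ioo_ofReal hx0]
    · have hi := intervalIntegrable_exactPdf (K := K) hM hlam
      refine IntervalIntegrable.continuousOn_mul (IntervalIntegrable.add ?_ ?_) (by fun_prop)
      · exact ((intervalIntegral.continuous_primitive hi 0).comp
          (continuous_const.sub continuous_id)).intervalIntegrable _ _
      · have := (hi (x - 0) (x - x)).comp_sub_left x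
        simp only [sub_sub_cancel] at this
        exact this.div_const lam
    · intro s hs
      have h2 : 0 ≤ ∫ t in (0 : ℝ)..(x - s), exactPdf M lam K t :=
        intervalIntegral.integral_nonneg (by linarith [hs.2]) fun t ht =>
          exactPdf_nonneg hM hlam ht.1
      have h3 := exactPdf_nonneg (K := K) hM hlam (x := x - s) (by linarith [hs.2])
      positivity
  · rw [(prob_compl_eq_zero_iff measurableSet_Iic).1 (measure_mono_null (hhigh x hxK) hsupp),
      (prob_compl_eq_zero_iff measurableSet_Iic).1 (measure_mono_null (hhigh x hxK) hnext)]

/-! ### Convergence to the stationary law and uniqueness -/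

/-- The probability of `A` after `n` steps, as a function of the initial buffer content. -/
noncomputable def stepProb (M lam K : ℝ) (A : Set ℝ) : ℕ → ℝ → ℝ
  | 0 => A.indicator 1
  | n + 1 => fun u => ∫ x, stepProb M lam K A n (storageStep M K u x)
      ∂ProbabilityTheory.expMeasure lam

theorem measurable_stepProb (hlam : 0 < lam) {A : Set ℝ} (hA : MeasurableSet A) (n : ℕ) :
    Measurable (stepProb M lam K A n) := by
  have := ProbabilityTheory.isProbabilityMeasure_expMeasure hlam
  induction n with
  | zero => exact measurable_one.indicator hA
  | succ n ih =>
    have h : StronglyMeasurable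
        (fun z : ℝ × ℝ => stepProb M lam K A n (storageStep M K z.1 z.2)) :=
      (ih.comp (measurable_storageStep M K)).stronglyMeasurable
    exact h.integral_prod_right.measurable

theorem stepProb_mem_Icc (hlam : 0 < lam) (A : Set ℝ) (n : ℕ) (u : ℝ) :
    stepProb M lam K A n u ∈ Icc (0 : ℝ) 1 := by
  have := ProbabilityTheory.isProbabilityMeasure_expMeasure hlam
  induction n generalizing u with
  | zero => by_cases h : u ∈ A <;> simp [stepProb, h]
  | succ n ih =>
    refine ⟨integral_nonneg fun x => (ih _).1, ?_⟩
    have := norm_integral_le_of_norm_le_const (μ := ProbabilityTheory.expMeasure lam) (C := 1)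
      (f := fun x => stepProb M lam K A n (storageStep M K u x))
      (ae_of_all _ fun x => by rw [Real.norm_of_nonneg (ih _).1]; exact (ih _).2)
    rw [probReal_univ, mul_one] at this
    exact (le_abs_self _).trans this

theorem integrable_stepProb_comp {Ω : Type*} [MeasurableSpace Ω] (μ : Measure Ω)
    [IsProbabilityMeasure μ] (hlam : 0 < lam) {A : Set ℝ} (hA : MeasurableSet A) (n : ℕ)
    {f : Ω → ℝ} (hf : Measurable f) : Integrable (fun ω => stepProb M lam K A n (f ω)) μ := by
  refine Integrable.of_bound ((measurable_stepProb hlam hA n).comp hf).aestronglyMeasurable 1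
    (ae_of_all _ fun ω => ?_)
  have := stepProb_mem_Icc (M := M) (K := K) hlam A n (f ω)
  rw [Real.norm_of_nonneg this.1]
  exact this.2

theorem iterate_nextLaw_real (hlam : 0 < lam) {A : Set ℝ} (hA : MeasurableSet A) (n : ℕ)
    (μ : Measure ℝ) [IsProbabilityMeasure μ] :
    ((nextLaw M lam K)^[n] μ).real A = ∫ u, stepProb M lam K A n u ∂μ := by
  have := ProbabilityTheory.isProbabilityMeasure_expMeasure hlam
  induction n generalizing μ with
  | zero => simp [stepProb, integral_indicator_one hA]
  | succ n ih =>
    have hnext := isProbabilityMeasure_nextLaw (M := M) (K := K) hlam μ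
    rw [Function.iterate_succ_apply, ih, nextLaw, integral_map
      (measurable_storageStep M K).aemeasurable
      (measurable_stepProb hlam hA n).aestronglyMeasurable, integral_prod _
      (integrable_stepProb_comp _ hlam hA n (measurable_storageStep M K))]
    rfl

/-- The Doeblin estimate: an arrival exceeding `K`, which has probability `exp (-lam * K)`, fills the
buffer whatever its content, so each step contracts the oscillation of `stepProb`. -/
theorem abs_stepProb_sub_le (hlam : 0 < lam) (hK : 0 ≤ K) {A : Set ℝ}
    (hA : MeasurableSet A) (n : ℕ) {u v : ℝ} (hu : u ∈ Icc 0 K) (hv : v ∈ Icc 0 K) :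
    |stepProb M lam K A n u - stepProb M lam K A n v| ≤ (1 - Real.exp (-(lam * K))) ^ n := by
  have := ProbabilityTheory.isProbabilityMeasure_expMeasure hlam
  induction n generalizing u v with
  | zero =>
    by_cases h1 : u ∈ A <;> by_cases h2 : v ∈ A <;> simp [stepProb, h1, h2]
  | succ n ih =>
    have hmeas : ∀ w : ℝ, Measurable fun x => storageStep M K w x := fun w =>
      (measurable_storageStep M K).comp measurable_prodMk_left
    have hle : ∀ w ∈ Icc 0 K, ∀ x, 0 ≤ x → 0 ≤ w - (if M < w then M else 0) + x := by
      intro w hw x hx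
      split_ifs <;> linarith [hw.1]
    have hmem : ∀ w ∈ Icc 0 K, ∀ x, 0 ≤ x → storageStep M K w x ∈ Icc 0 K := fun w hw x hx =>
      ⟨le_min (hle w hw x hx) hK, min_le_right _ _⟩
    have hfull : ∀ w ∈ Icc 0 K, ∀ x, K < x → storageStep M K w x = K := by
      intro w hw x hx
      have := hle w hw 0 le_rfl
      exact min_eq_right (by linarith)
    have hcdf : (ProbabilityTheory.expMeasure lam).real (Iic K) = 1 - Real.exp (-(lam * K)) := by
      rw [← ProbabilityTheory.cdf_eq_real, ProbabilityTheory.cdf_expMeasure_eq hlam, if_pos hK]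
    have hi := fun w => integrable_stepProb_comp (M := M) (K := K)
      (ProbabilityTheory.expMeasure lam) hlam hA n (hmeas w)
    have hle1 : Real.exp (-(lam * K)) ≤ 1 :=
      Real.exp_le_one_iff.2 (neg_nonpos.2 (mul_nonneg hlam.le hK))
    simp only [stepProb]
    rw [← integral_sub (hi u) (hi v)]
    calc |∫ x, (stepProb M lam K A n (storageStep M K u x) -
            stepProb M lam K A n (storageStep M K v x)) ∂ProbabilityTheory.expMeasure lam|
        ≤ ∫ x, (Iic K).indicator (fun _ => (1 - Real.exp (-(lam * K))) ^ n) x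
            ∂ProbabilityTheory.expMeasure lam := by
          rw [← Real.norm_eq_abs]
          refine norm_integral_le_of_norm_le
            ((integrable_const ((1 - Real.exp (-(lam * K))) ^ n)).indicator
              (measurableSet_Iic (a := K))) ?_
          filter_upwards [ae_expMeasure_nonneg lam] with x hx
          by_cases hxK : x ∈ Iic K
          · rw [indicator_of_mem hxK]
            exact ih (hmem u hu x hx) (hmem v hv x hx)
          · rw [indicator_of_notMem hxK]
            have hx' : K < x := by simpa using hxK
            rw [hfull u hu x hx', hfull v hv x hx', sub_self, norm_zero]
      _ = (1 - Real.exp (-(lam * K))) ^ (n + 1) := by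
          rw [integral_indicator measurableSet_Iic, setIntegral_const, hcdf, smul_eq_mul, pow_succ,
            mul_comm]

theorem abs_integral_stepProb_sub_le (hlam : 0 < lam) (hK : 0 ≤ K) {A : Set ℝ}
    (hA : MeasurableSet A) (n : ℕ) (μ : Measure ℝ) [IsProbabilityMeasure μ]
    (hμ : μ (Icc 0 K)ᶜ = 0) :
    |(∫ u, stepProb M lam K A n u ∂μ) - stepProb M lam K A n 0| ≤
      (1 - Real.exp (-(lam * K))) ^ n := by
  have hi := integrable_stepProb_comp (M := M) (K := K) μ hlam hA n measurable_id
  simp only [id] at hi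
  have h1 : (∫ u, stepProb M lam K A n u ∂μ) - stepProb M lam K A n 0 =
      ∫ u, (stepProb M lam K A n u - stepProb M lam K A n 0) ∂μ := by
    rw [integral_sub hi (integrable_const _), integral_const, probReal_univ, one_smul]
  rw [h1]
  have h2 := norm_integral_le_of_norm_le_const (μ := μ)
    (f := fun u => stepProb M lam K A n u - stepProb M lam K A n 0)
    (C := (1 - Real.exp (-(lam * K))) ^ n) (by
      have : ∀ᵐ u ∂μ, u ∈ Icc 0 K := by rw [ae_iff]; exact hμ
      filter_upwards [this] with u hu
      exact abs_stepProb_sub_le hlam hK hA n hu ⟨le_rfl, hK⟩)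
  rwa [probReal_univ, mul_one] at h2

/-- The explicit law is the limiting distribution, at a geometric rate given by the Doeblin
estimate. -/
theorem isLimitingDistribution_exactLaw (hM : 0 < M) (hlam : 0 < lam) (hK : 2 * M ≤ K) :
    IsLimitingDistribution M lam K (exactLaw M lam K) := by
  have hK0 : 0 ≤ K := by linarith
  have hstat := nextLaw_exactLaw hM hlam hK
  have hprob := isProbabilityMeasure_exactLaw hM hlam hK
  have hsupp := exactLaw_compl_Icc (M := M) (lam := lam) hK0
  refine ⟨hprob, hsupp, hstat, fun μ hμ hμs ε hε => ?_⟩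
  have hlim : Tendsto (fun n : ℕ => 2 * (1 - Real.exp (-(lam * K))) ^ n) atTop (𝓝 (2 * 0)) :=
    (tendsto_pow_atTop_nhds_zero_of_lt_one
      (sub_nonneg.2 (Real.exp_le_one_iff.2 (neg_nonpos.2 (mul_nonneg hlam.le hK0))))
      (sub_lt_self _ (Real.exp_pos _))).const_mul 2
  rw [mul_zero] at hlim
  filter_upwards [hlim.eventually (ge_mem_nhds hε)] with n hn A hA
  have h1 := abs_integral_stepProb_sub_le (M := M) hlam hK0 hA n μ hμs
  have h2 := abs_integral_stepProb_sub_le (M := M) hlam hK0 hA n (exactLaw M lam K) hsupp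
  have h3 := iterate_nextLaw_real (M := M) (K := K) hlam hA n (exactLaw M lam K)
  rw [Function.iterate_fixed hstat] at h3
  rw [iterate_nextLaw_real hlam hA, h3]
  rw [abs_le] at h1 h2 ⊢
  constructor <;> linarith [h1.1, h1.2, h2.1, h2.2]

theorem IsLimitingDistribution.unique {μ ν : Measure ℝ} (hμ : IsLimitingDistribution M lam K μ)
    (hν : IsLimitingDistribution M lam K ν) : μ = ν := by
  have := hμ.prob
  have := hν.prob
  refine Measure.ext fun A hA => (measureReal_eq_measureReal_iff).1 ?_
  refine eq_of_abs_sub_eq_zero (le_antisymm (le_of_forall_pos_le_add fun ε hε => ?_) (abs_nonneg _))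
  obtain ⟨n, hn⟩ := (hν.limiting μ hμ.prob hμ.support ε hε).exists
  have := hn A hA
  rwa [Function.iterate_fixed hμ.stationary, ← zero_add ε] at this

theorem isLimitingPdf_exactPdf (hM : 0 < M) (hlam : 0 < lam) (hK : 2 * M ≤ K) :
    IsLimitingPdf M lam K (exactPdf M lam K) (exactAtom M lam K) where
  nonneg x hx := exactPdf_nonneg hM hlam hx.1
  right_cont x _ := continuousWithinAt_exactPdf hM x
  integrable := ((intervalIntegrable_iff_integrableOn_Ioc_of_le (by linarith)).1
    (intervalIntegrable_exactPdf hM hlam 0 K)).mono_set Ioo_subset_Ioc_self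
  atom_nonneg := (exactAtom_pos hM hlam).le
  law := isLimitingDistribution_exactLaw hM hlam hK

/-- Two right-continuous functions that agree almost everywhere on `(0, K)` agree on `[0, K)`. -/
theorem eqOn_Ico_of_ae_eq {f g : ℝ → ℝ} (hf : ∀ x ∈ Ico 0 K, ContinuousWithinAt f (Ici x) x)
    (hg : ∀ x ∈ Ico 0 K, ContinuousWithinAt g (Ici x) x)
    (h : f =ᵐ[volume.restrict (Ioo 0 K)] g) : EqOn f g (Ico 0 K) := by
  intro x hx
  -- agreement almost everywhere gives points of agreement arbitrarily close to the right of `x`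
  have hfreq : ∃ᶠ y in 𝓝[>] x, f y = g y := by
    intro hev
    obtain ⟨b, hb, hsub⟩ := (mem_nhdsGT_iff_exists_Ioo_subset' hx.2).1 hev
    have hb0 : 0 < volume (Ioo x (min b K)) := by
      rw [Real.volume_Ioo, ENNReal.ofReal_pos, sub_pos]
      exact lt_min hb hx.2
    have hnull : volume (Ioo x (min b K)) = 0 := by
      have h' := (ae_restrict_iff' measurableSet_Ioo).1 h
      refine measure_mono_null (fun y hy => ?_) (ae_iff.1 h')
      simp only [mem_ofPred_eq]
      intro hcon
      exact hsub ⟨hy.1, hy.2.trans_le (min_le_left _ _)⟩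
        (hcon ⟨hx.1.trans_lt hy.1, hy.2.trans_le (min_le_right _ _)⟩)
    exact hb0.ne' hnull
  have hf' : Tendsto f (𝓝[>] x) (𝓝 (f x)) := (hf x hx).mono Ioi_subset_Ici_self
  have hg' : Tendsto g (𝓝[>] x) (𝓝 (g x)) := (hg x hx).mono Ioi_subset_Ici_self
  by_contra hne
  have := (hf'.sub hg').eventually (isOpen_ne.mem_nhds (sub_ne_zero.2 hne))
  exact hfreq (this.mono fun y hy h => hy (sub_eq_zero.2 h))

/-- The limiting density and atom are the explicit ones. -/
theorem IsLimitingPdf.eq_exact (hM : 0 < M) (hlam : 0 < lam) (hK : 2 * M ≤ K) {g : ℝ → ℝ} {a : ℝ}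
    (h : IsLimitingPdf M lam K g a) :
    a = exactAtom M lam K ∧ EqOn g (exactPdf M lam K) (Ico 0 K) := by
  have he := isLimitingPdf_exactPdf hM hlam hK
  have hlaw : bufferLaw K g a = bufferLaw K (exactPdf M lam K) (exactAtom M lam K) :=
    h.law.unique he.law
  have hatom : ∀ (f : ℝ → ℝ) (b : ℝ), bufferLaw K f b {K} = ENNReal.ofReal b := by
    intro f b
    rw [bufferLaw_apply _ _ _ (measurableSet_singleton K)]
    simp
  have ha : a = exactAtom M lam K := by
    have := congrArg (fun ν => ν {K}) hlaw
    simp only [hatom] at this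
    exact (ENNReal.ofReal_eq_ofReal_iff h.atom_nonneg he.atom_nonneg).1 this
  refine ⟨ha, eqOn_Ico_of_ae_eq h.right_cont he.right_cont ?_⟩
  have hd : (volume.restrict (Ioo 0 K)).withDensity (fun x => ENNReal.ofReal (g x)) =
      (volume.restrict (Ioo 0 K)).withDensity
        (fun x => ENNReal.ofReal (exactPdf M lam K x)) := by
    refine Measure.ext fun A hA => ?_
    have := congrArg (fun ν => ν A) hlaw
    simp only [bufferLaw, Measure.add_apply, ha] at this
    refine (ENNReal.add_left_inj ?_).1 this
    rw [Measure.smul_apply, Measure.dirac_apply' _ hA, smul_eq_mul]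
    exact ENNReal.mul_ne_top ENNReal.ofReal_ne_top
      (by by_cases hKA : K ∈ A <;> simp [hKA])
  have hfin : ∫⁻ x in Ioo 0 K, ENNReal.ofReal (g x) ≠ ⊤ :=
    (h.integrable.lintegral_lt_top).ne
  have hae := (withDensity_eq_iff h.integrable.aemeasurable.ennreal_ofReal
    he.integrable.aemeasurable.ennreal_ofReal hfin).1 hd
  filter_upwards [hae, ae_restrict_mem measurableSet_Ioo] with x hx hxm
  exact (ENNReal.ofReal_eq_ofReal_iff (h.nonneg x ⟨hxm.1.le, hxm.2⟩)
    (he.nonneg x ⟨hxm.1.le, hxm.2⟩)).1 hx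

/-! ### The rate of the approximation -/

theorem neg_mul_exp_neg_ge (x : ℝ) : (-1) * Real.exp (-1) ≤ -x * Real.exp (-x) := by
  have h1 : x ≤ Real.exp (x - 1) := by linarith [Real.add_one_le_exp (x - 1)]
  have h2 : x * Real.exp (-x) ≤ Real.exp (x - 1) * Real.exp (-x) := by gcongr
  rw [← Real.exp_add, show x - 1 + -x = -1 by ring] at h2
  linarith

theorem eq_neg_one_of_mul_exp {w : ℝ} (h : w * Real.exp w = (-1) * Real.exp (-1)) : w = -1 := by
  by_contra hne
  have h1 : -w < Real.exp (-w - 1) := by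
    have := Real.add_one_lt_exp (x := -w - 1) (fun h0 => hne (by linarith))
    linarith
  have h2 : -w * Real.exp w < Real.exp (-w - 1) * Real.exp w :=
    mul_lt_mul_of_pos_right h1 (Real.exp_pos _)
  rw [← Real.exp_add, show -w - 1 + w = -1 by ring] at h2
  linarith

theorem lambertW0_spec {z : ℝ} (h1 : (-1) * Real.exp (-1) ≤ z) (h2 : z ≤ 0) :
    -1 ≤ lambertW0 z ∧ lambertW0 z * Real.exp (lambertW0 z) = z := by
  have hex : ∃ w ∈ Ici (-1 : ℝ), w * Real.exp w = z := by
    obtain ⟨w, hw, hwz⟩ := intermediate_value_Icc (f := fun w : ℝ => w * Real.exp w)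
      (show (-1 : ℝ) ≤ 0 by norm_num) (by fun_prop) (⟨h1, by simpa using h2⟩)
    exact ⟨w, hw.1, hwz⟩
  exact ⟨Function.invFunOn_mem hex, Function.invFunOn_eq hex⟩

theorem lambertWNegOne_spec {z : ℝ} (h1 : (-1) * Real.exp (-1) ≤ z) (h2 : z < 0) :
    lambertWNegOne z ≤ -1 ∧ lambertWNegOne z * Real.exp (lambertWNegOne z) = z := by
  have hex : ∃ w ∈ Iic (-1 : ℝ), w * Real.exp w = z := by
    have hlim := (Real.tendsto_pow_mul_exp_neg_atTop_nhds_zero 1).eventually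
      (gt_mem_nhds (neg_pos.2 h2))
    obtain ⟨b, hb, hb1⟩ := (hlim.and (eventually_ge_atTop 1)).exists
    obtain ⟨w, hw, hwz⟩ := intermediate_value_Icc' (f := fun w : ℝ => w * Real.exp w)
      (show -b ≤ -1 by linarith) (by fun_prop) (⟨h1, by simp only [pow_one] at hb; linarith⟩)
    exact ⟨w, hw.2, hwz⟩
  exact ⟨Function.invFunOn_mem hex, Function.invFunOn_eq hex⟩

/-- The two cases of the rate share the form `(-lam * M - w) / M`, where `w` solves the Lambert
equation and lies, weakly, on the other side of `-1` than `-lam * M`. -/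
theorem exists_approxRate_eq (hM : 0 < M) (hlam : 0 < lam) :
    ∃ w : ℝ, approxRate M lam = (-(lam * M) - w) / M ∧
      w * Real.exp w = -(lam * M) * Real.exp (-(lam * M)) ∧
      (lam * M ≤ 1 → w ≤ -1) ∧ (1 < lam * M → -1 ≤ w) := by
  have hd : 0 < lam * M := by positivity
  have h1 := neg_mul_exp_neg_ge (lam * M)
  have h2 : -(lam * M) * Real.exp (-(lam * M)) < 0 :=
    mul_neg_of_neg_of_pos (by linarith) (Real.exp_pos _)
  unfold approxRate
  split_ifs with h
  · obtain ⟨h3, h4⟩ := lambertWNegOne_spec h1 h2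
    exact ⟨_, rfl, h4, fun _ => h3, fun h5 => absurd h (not_le.2 h5)⟩
  · obtain ⟨h3, h4⟩ := lambertW0_spec h1 h2.le
    exact ⟨_, rfl, h4, fun h5 => absurd h5 h, fun _ => h3⟩

/-- The characteristic equation of the delay equation. -/
theorem approxRate_add (hM : 0 < M) (hlam : 0 < lam) :
    approxRate M lam + lam = lam * Real.exp (approxRate M lam * M) := by
  obtain ⟨w, h1, h2, -, -⟩ := exists_approxRate_eq hM hlam
  have h3 : approxRate M lam * M = -(lam * M) - w := by rw [h1]; field_simp
  have h4 : Real.exp (-(lam * M) - w) * Real.exp w = Real.exp (-(lam * M)) := by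
    rw [← Real.exp_add]; ring_nf
  have h5 : lam * M * Real.exp (-(lam * M) - w) = -w := by
    have : (lam * M * Real.exp (-(lam * M) - w) + w) * Real.exp w = 0 := by
      linear_combination lam * M * h4 + h2
    have := (mul_eq_zero.1 this).resolve_right (Real.exp_pos _).ne'
    linarith
  have h6 : (approxRate M lam + lam - lam * Real.exp (approxRate M lam * M)) * M = 0 := by
    rw [h3]; linear_combination h3 - h5
  have := (mul_eq_zero.1 h6).resolve_right hM.ne'
  linarith

theorem approxRate_eq_zero (hM : 0 < M) (hlam : 0 < lam) (h : lam * M = 1) :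
    approxRate M lam = 0 := by
  obtain ⟨w, h1, h2, -, -⟩ := exists_approxRate_eq hM hlam
  rw [h] at h1 h2
  rw [h1, eq_neg_one_of_mul_exp h2]
  simp

theorem approxRate_ne_zero (hM : 0 < M) (hlam : 0 < lam) (h : lam * M ≠ 1) :
    approxRate M lam ≠ 0 := by
  obtain ⟨w, h1, -, h3, h4⟩ := exists_approxRate_eq hM hlam
  rw [h1]
  refine div_ne_zero (fun h0 => ?_) hM.ne'
  rcases lt_or_gt_of_ne h with h5 | h5
  · linarith [h3 h5.le]
  · linarith [h4 h5]

theorem approxRate_neg (hM : 0 < M) (hlam : 0 < lam) (h : 1 < lam * M) :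
    approxRate M lam < 0 := by
  obtain ⟨w, h1, -, -, h4⟩ := exists_approxRate_eq hM hlam
  rw [h1]
  exact div_neg_of_neg_of_pos (by linarith [h4 h]) hM

/-- The load `lam * exp (d * M) * M` conjugate to a load above `1` is below `1`. -/
theorem approxRate_add_mul_lt_one (hM : 0 < M) (hlam : 0 < lam) (h : 1 < lam * M) :
    (approxRate M lam + lam) * M < 1 := by
  obtain ⟨w, h1, h2, -, h4⟩ := exists_approxRate_eq hM hlam
  have h3 : approxRate M lam * M = -(lam * M) - w := by rw [h1]; field_simp
  have h5 : w ≠ -1 := by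
    rintro rfl
    have := eq_neg_one_of_mul_exp h2.symm
    linarith
  have := lt_of_le_of_ne (h4 h) h5.symm
  linarith

/-! ### The approximate law is a probability distribution -/

theorem integral_exp_mul_eq {d : ℝ} (hd : d ≠ 0) (a b : ℝ) :
    ∫ x in a..b, Real.exp (d * x) = (Real.exp (d * b) - Real.exp (d * a)) / d := by
  rw [intervalIntegral.integral_comp_mul_left (fun x => Real.exp x) hd, integral_exp, smul_eq_mul]
  ring

/-- A form of `approxFirst` that covers the critical load, where the rate is `0`. -/
theorem approxFirst_eq (hM : 0 < M) (hlam : 0 < lam) (l nc : ℕ) (x : ℝ) :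
    approxFirst M lam l nc x = approxCoeff M lam l nc *
      (lam * Real.exp (approxRate M lam * M) * ∫ u in (0 : ℝ)..x, Real.exp (approxRate M lam * u)) := by
  unfold approxFirst
  split_ifs with h
  · rw [approxRate_eq_zero hM hlam h]
    simp
    ring
  · rw [integral_exp_mul_eq (approxRate_ne_zero hM hlam h)]
    simp
    ring

/-- `Σ₂` is the mass, in units of the atom, of the part of the approximate law below
`K - nc * M`. -/
theorem sigma2_eq (hM : 0 < M) (hlam : 0 < lam) (l nc : ℕ) :
    sigma2 M lam l nc = lam * sigma1 M lam l *
      ((∫ x in (0 : ℝ)..M, lam * Real.exp (approxRate M lam * M) *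
          ∫ u in (0 : ℝ)..x, Real.exp (approxRate M lam * u)) +
        ∫ x in M..(l * M - nc * M), Real.exp (approxRate M lam * x)) := by
  unfold sigma2
  split_ifs with h
  · rw [approxRate_eq_zero hM hlam h]
    simp
    left
    rw [intervalIntegral.integral_const_mul, integral_id]
    linear_combination (-M / 2) * h
  · have hd := approxRate_ne_zero hM hlam h
    have hroot := approxRate_add hM hlam
    have hi : IntervalIntegrable (fun x => Real.exp (approxRate M lam * x)) volume 0 M :=
      Continuous.intervalIntegrable (by fun_prop) _ _
    simp_rw [integral_exp_mul_eq hd]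
    simp only [mul_zero, Real.exp_zero]
    rw [intervalIntegral.integral_const_mul, intervalIntegral.integral_div,
      intervalIntegral.integral_sub hi intervalIntegrable_const, integral_exp_mul_eq hd]
    simp only [intervalIntegral.integral_const, smul_eq_mul, mul_zero, Real.exp_zero]
    set E := Real.exp (approxRate M lam * M) with hE
    field_simp
    linear_combination (sigma1 M lam l * E) * hroot

theorem sigma1_pos (hM : 0 < M) (hlam : 0 < lam) {l : ℕ} (hl : 1 ≤ l) : 0 < sigma1 M lam l := by
  rw [sigma1_eq hM hl]
  exact tailFun_diff_pos hM hlam (by positivity)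

theorem integral_exp_rate_nonneg (d : ℝ) {a b : ℝ} (h : a ≤ b) :
    0 ≤ ∫ u in a..b, Real.exp (d * u) :=
  intervalIntegral.integral_nonneg h fun _ _ => (Real.exp_pos _).le

theorem le_mul_sub_mul (hM : 0 < M) {l nc : ℕ} (h : nc + 1 ≤ l) : M ≤ (l : ℝ) * M - nc * M := by
  have : (nc : ℝ) + 1 ≤ l := by exact_mod_cast h
  nlinarith

theorem sigma2_nonneg (hM : 0 < M) (hlam : 0 < lam) {l nc : ℕ} (h : nc + 1 ≤ l) :
    0 ≤ sigma2 M lam l nc := by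
  rw [sigma2_eq hM hlam]
  have h1 := (sigma1_pos hM hlam (l := l) (by omega)).le
  refine mul_nonneg (by positivity) (add_nonneg ?_ (integral_exp_rate_nonneg _ (le_mul_sub_mul hM h)))
  exact intervalIntegral.integral_nonneg hM.le fun x hx =>
    mul_nonneg (by positivity) (integral_exp_rate_nonneg _ hx.1)

theorem approxAtom_eq (hM : 0 < M) (l nc : ℕ) : approxAtom M lam l nc =
    (sigma2 M lam l nc + if nc = 0 then 1 else tailFun M lam (nc * M))⁻¹ := by
  rw [approxAtom, add_right_comm, one_add_sum_eq hM, add_comm]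

/-- For `nc = 0` the value `1` is the right limit of `tailFun` at `0`, where `tailFun` itself is `0`. -/
theorem one_le_ite_tailFun (hM : 0 < M) (hlam : 0 < lam) (nc : ℕ) :
    1 ≤ if nc = 0 then 1 else tailFun M lam (nc * M) := by
  split_ifs with h
  · exact le_rfl
  · exact one_le_tailFun hM hlam (by positivity)

theorem approxAtom_pos (hM : 0 < M) (hlam : 0 < lam) {l nc : ℕ} (h : nc + 1 ≤ l) :
    0 < approxAtom M lam l nc := by
  rw [approxAtom_eq hM]
  have := one_le_ite_tailFun hM hlam nc
  have := sigma2_nonneg hM hlam h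
  positivity

theorem approxCoeff_pos (hM : 0 < M) (hlam : 0 < lam) {l nc : ℕ} (h : nc + 1 ≤ l) :
    0 < approxCoeff M lam l nc :=
  mul_pos (mul_pos (approxAtom_pos hM hlam h) hlam) (sigma1_pos hM hlam (by omega))

theorem approxPdf_of_lt {l nc : ℕ} {x : ℝ} (hx : x < M) :
    approxPdf M lam l nc x = approxFirst M lam l nc x := if_pos hx

theorem approxPdf_of_mid {l nc : ℕ} {x : ℝ} (hx : M ≤ x) (hx2 : x < l * M - nc * M) :
    approxPdf M lam l nc x = approxMiddle M lam l nc x := by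
  rw [approxPdf, if_neg (not_lt.2 hx), if_pos hx2]

theorem approxPdf_of_ge (hM : 0 < M) {l nc : ℕ} (h : nc + 1 ≤ l) {x : ℝ} (hx : l * M - nc * M ≤ x)
    (hxK : x < l * M) : approxPdf M lam l nc x = approxAtom M lam l nc * lam *
      (tailFun M lam (l * M - x) - tailFun M lam (l * M - x - M)) := by
  rw [approxPdf, if_neg (not_lt.2 ((le_mul_sub_mul hM h).trans hx)), if_neg (not_lt.2 hx),
    sectionExpr_ceil_eq hM hxK]

theorem approxPdf_nonneg (hM : 0 < M) (hlam : 0 < lam) {l nc : ℕ} (h : nc + 1 ≤ l) {x : ℝ}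
    (hx : 0 ≤ x) (hxK : x < l * M) : 0 ≤ approxPdf M lam l nc x := by
  have hc := approxCoeff_pos hM hlam h
  have ha := approxAtom_pos hM hlam h
  rcases lt_or_ge x M with h1 | h1
  · rw [approxPdf_of_lt h1, approxFirst_eq hM hlam]
    have := integral_exp_rate_nonneg (approxRate M lam) hx
    positivity
  rcases lt_or_ge x (l * M - nc * M) with h2 | h2
  · rw [approxPdf_of_mid h1 h2, approxMiddle]
    positivity
  · rw [approxPdf_of_ge hM h h2 hxK]
    exact mul_nonneg (by positivity) (tailFun_diff_nonneg hM hlam _)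

theorem continuous_approxFirst (l nc : ℕ) : Continuous (approxFirst M lam l nc) := by
  unfold approxFirst
  split_ifs <;> fun_prop

theorem intervalIntegrable_and_integral_approxPdf (hM : 0 < M) (hlam : 0 < lam) {l nc : ℕ}
    (h : nc + 1 ≤ l) :
    IntervalIntegrable (approxPdf M lam l nc) volume 0 (l * M) ∧
      (∫ x in (0 : ℝ)..(l * M), approxPdf M lam l nc x) + approxAtom M lam l nc = 1 := by
  have hb := le_mul_sub_mul hM h
  have hb2 : (l : ℝ) * M - nc * M ≤ l * M := by
    have : 0 ≤ (nc : ℝ) * M := by positivity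
    linarith
  have e1 : (uIoo 0 M).EqOn (approxPdf M lam l nc) (approxFirst M lam l nc) := by
    intro x hx
    rw [uIoo_of_le hM.le] at hx
    exact approxPdf_of_lt hx.2
  have e2 : (uIoo M (l * M - nc * M)).EqOn (approxPdf M lam l nc) (approxMiddle M lam l nc) := by
    intro x hx
    rw [uIoo_of_le hb] at hx
    exact approxPdf_of_mid hx.1.le hx.2
  set ψ : ℝ → ℝ := fun x => approxAtom M lam l nc * lam *
      (tailFun M lam (l * M - x) - tailFun M lam (l * M - x - M)) with hψ
  have e3 : (uIoo (l * M - nc * M) (l * M)).EqOn (approxPdf M lam l nc) ψ := by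
    intro x hx
    rw [uIoo_of_le hb2] at hx
    exact approxPdf_of_ge hM h hx.1.le hx.2
  have i1 : IntervalIntegrable (approxPdf M lam l nc) volume 0 M :=
    ((continuous_approxFirst l nc).intervalIntegrable _ _).congr_uIoo e1.symm
  have i2 : IntervalIntegrable (approxPdf M lam l nc) volume M (l * M - nc * M) := by
    refine IntervalIntegrable.congr_uIoo (Continuous.intervalIntegrable ?_ _ _) e2.symm
    unfold approxMiddle; fun_prop
  have i3 : IntervalIntegrable (approxPdf M lam l nc) volume (l * M - nc * M) (l * M) := by
    refine IntervalIntegrable.congr_uIoo (IntervalIntegrable.const_mul ?_ _) e3.symm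
    have := (intervalIntegrable_tailFun_diff (r := lam) hM (l * M - (l * M - nc * M))
      (l * M - l * M)).comp_sub_left (l * M)
    simpa only [sub_sub_cancel] using this
  refine ⟨(i1.trans i2).trans i3, ?_⟩
  rw [← intervalIntegral.integral_add_adjacent_intervals (i1.trans i2) i3,
    ← intervalIntegral.integral_add_adjacent_intervals i1 i2,
    intervalIntegral.integral_congr_uIoo e1, intervalIntegral.integral_congr_uIoo e2,
    intervalIntegral.integral_congr_uIoo e3]
  have j1 : ∫ x in (0 : ℝ)..M, approxFirst M lam l nc x = approxCoeff M lam l nc *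
      ∫ x in (0 : ℝ)..M, lam * Real.exp (approxRate M lam * M) *
          ∫ u in (0 : ℝ)..x, Real.exp (approxRate M lam * u) := by
    rw [← intervalIntegral.integral_const_mul]
    exact intervalIntegral.integral_congr fun x _ => approxFirst_eq hM hlam l nc x
  have j2 : ∫ x in M..(l * M - nc * M), approxMiddle M lam l nc x = approxCoeff M lam l nc *
      ∫ x in M..(l * M - nc * M), Real.exp (approxRate M lam * x) := by
    rw [← intervalIntegral.integral_const_mul]; rfl
  have j3 : ∫ x in (l * M - nc * M)..(l * M), ψ x = approxAtom M lam l nc *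
      ((if nc = 0 then 1 else tailFun M lam (nc * M)) - 1) := by
    simp only [hψ]
    rw [intervalIntegral.integral_const_mul, intervalIntegral.integral_comp_sub_left
      (fun t => tailFun M lam t - tailFun M lam (t - M)) (l * M), sub_self, sub_sub_cancel]
    split_ifs with h0
    · simp [h0]
    · rw [tailFun_eq_one_add (y := nc * M) hM (by positivity)]
      ring
  have hN := one_le_ite_tailFun hM hlam nc
  have hS := sigma2_nonneg hM hlam h
  have hinv : approxAtom M lam l nc *
      (sigma2 M lam l nc + if nc = 0 then 1 else tailFun M lam (nc * M)) = 1 := by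
    rw [approxAtom_eq hM]
    exact inv_mul_cancel₀ (by positivity)
  rw [j1, j2, j3, approxCoeff]
  rw [sigma2_eq hM hlam] at hinv
  linear_combination hinv

/-- The Volterra equation on the first section. After multiplication by `exp (lam * x)` the right-hand
side is the integral over `[0, x]` of the derivative of the left-hand side, which vanishes at `0`. -/
theorem approxPdf_volterra (hM : 0 < M) (hlam : 0 < lam) (l nc : ℕ) {x : ℝ} (hx : 0 ≤ x)
    (hxM : x < M) :
    approxPdf M lam l nc x =
      (∫ u in (0 : ℝ)..x, lam * Real.exp (-lam * (x - u)) * approxPdf M lam l nc u) +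
        ∫ u in M..(M + x), lam * Real.exp (-lam * (x - u + M)) * approxMiddle M lam l nc u := by
  set c := approxCoeff M lam l nc with hc
  set d := approxRate M lam with hd
  set f := approxFirst M lam l nc with hf
  have hfc : Continuous f := continuous_approxFirst l nc
  have hfd : ∀ u, HasDerivAt f (c * (lam * Real.exp (d * M) * Real.exp (d * u))) u := by
    intro u
    have h1 : f = fun x => c * (lam * Real.exp (d * M) * ∫ u in (0 : ℝ)..x, Real.exp (d * u)) :=
      funext fun x => approxFirst_eq hM hlam l nc x
    rw [h1]
    have h2 : Continuous fun u => Real.exp (d * u) := by fun_prop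
    exact (((h2.integral_hasStrictDerivAt 0 u).hasDerivAt).const_mul _).const_mul c
  have hf0 : f 0 = 0 := by simp [hf, approxFirst]
  have hG : ∀ u ∈ uIcc 0 x, HasDerivAt (fun u => Real.exp (lam * u) * f u)
      (Real.exp (lam * u) * (lam * f u + c * (lam * Real.exp (d * M) * Real.exp (d * u)))) u := by
    intro u _
    have h1 : HasDerivAt (fun u => Real.exp (lam * u)) (Real.exp (lam * u) * (lam * 1)) u :=
      ((hasDerivAt_id u).const_mul lam).exp
    exact (h1.mul (hfd u)).congr_deriv (by ring)
  have key := intervalIntegral.integral_eq_sub_of_hasDerivAt hG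
    (Continuous.intervalIntegrable (by fun_prop) _ _)
  rw [hf0, mul_zero, sub_zero] at key
  have h1 : ∫ u in (0 : ℝ)..x, lam * Real.exp (-lam * (x - u)) * approxPdf M lam l nc u =
      ∫ u in (0 : ℝ)..x, lam * Real.exp (-lam * (x - u)) * f u := by
    refine intervalIntegral.integral_congr_uIoo fun u hu => ?_
    rw [uIoo_of_le hx] at hu
    rw [approxPdf_of_lt (hu.2.trans hxM)]
  have h2 : ∫ u in M..(M + x), lam * Real.exp (-lam * (x - u + M)) * approxMiddle M lam l nc u =
      ∫ u in (0 : ℝ)..x, lam * Real.exp (-lam * (x - u)) * (c * Real.exp (d * (u + M))) := by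
    have := intervalIntegral.integral_comp_add_right (a := 0) (b := x)
      (fun u => lam * Real.exp (-lam * (x - u + M)) * approxMiddle M lam l nc u) M
    rw [zero_add, add_comm x M] at this
    rw [← this]
    refine intervalIntegral.integral_congr fun u _ => ?_
    simp only [approxMiddle]
    rw [show x - (u + M) + M = x - u by ring]
  rw [approxPdf_of_lt hxM, h1, h2, ← intervalIntegral.integral_add
    (Continuous.intervalIntegrable (by fun_prop) _ _)
    (Continuous.intervalIntegrable (by fun_prop) _ _)]
  have h3 : ∀ u, lam * Real.exp (-lam * (x - u)) * f u +
      lam * Real.exp (-lam * (x - u)) * (c * Real.exp (d * (u + M))) = Real.exp (-(lam * x)) *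
      (Real.exp (lam * u) * (lam * f u + c * (lam * Real.exp (d * M) * Real.exp (d * u)))) := by
    intro u
    have e1 : Real.exp (-lam * (x - u)) = Real.exp (-(lam * x)) * Real.exp (lam * u) := by
      rw [← Real.exp_add]; ring_nf
    have e2 : Real.exp (d * (u + M)) = Real.exp (d * M) * Real.exp (d * u) := by
      rw [← Real.exp_add]; ring_nf
    rw [e1, e2]; ring
  simp_rw [h3]
  rw [intervalIntegral.integral_const_mul, key, ← mul_assoc, ← Real.exp_add]
  simp [hf]

/-! ### Asymptotics of the tail function -/

/-- The window identity combined with monotonicity. -/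
theorem tailFun_window_bounds (hM : 0 < M) (hr : 0 < r) {y : ℝ} (hy : 0 < y) :
    1 + r * M * tailFun M r (y - M) ≤ tailFun M r y ∧
      tailFun M r y ≤ 1 + r * M * tailFun M r y := by
  have hi := intervalIntegrable_tailFun (r := r) hM (y - M) y
  have hmono := monotone_tailFun hM hr
  have h1 := intervalIntegral.integral_mono_on (by linarith)
    (intervalIntegrable_const (c := tailFun M r (y - M))) hi fun t ht => hmono ht.1
  have h2 := intervalIntegral.integral_mono_on (by linarith) hi
    (intervalIntegrable_const (c := tailFun M r y)) fun t ht => hmono ht.2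
  rw [intervalIntegral.integral_const, smul_eq_mul, sub_sub_cancel] at h1 h2
  have h3 := tailFun_eq_window (r := r) hM hy
  constructor
  · rw [h3]; nlinarith
  · calc tailFun M r y = 1 + r * ∫ t in (y - M)..y, tailFun M r t := h3
      _ ≤ 1 + r * (M * tailFun M r y) := by gcongr
      _ = _ := by ring

theorem tailFun_le_of_lt_one (hM : 0 < M) (hr : 0 < r) (h : r * M < 1) (y : ℝ) :
    tailFun M r y ≤ (1 - r * M)⁻¹ := by
  have h1 : 0 < 1 - r * M := by linarith
  rcases le_or_gt y 0 with hy | hy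
  · rw [tailFun_of_nonpos hM hy]; positivity
  · rw [← one_div, le_div_iff₀ h1]
    linarith [(tailFun_window_bounds hM hr hy).2]

/-- For a load below `1` the tail function increases to a finite limit. -/
theorem tendsto_tailFun (hM : 0 < M) (hr : 0 < r) (h : r * M < 1) :
    Tendsto (tailFun M r) atTop (𝓝 (1 - r * M)⁻¹) := by
  have hlim := tendsto_atTop_ciSup (monotone_tailFun hM hr)
    ⟨(1 - r * M)⁻¹, by rintro _ ⟨y, rfl⟩; exact tailFun_le_of_lt_one hM hr h y⟩
  set L := ⨆ y, tailFun M r y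
  have hshift : Tendsto (fun y => 1 + r * M * tailFun M r (y - M)) atTop (𝓝 (1 + r * M * L)) :=
    ((hlim.comp (tendsto_atTop_add_const_right atTop (-M) tendsto_id)).const_mul _).const_add 1
  have h1 : 1 + r * M * L ≤ L := le_of_tendsto_of_tendsto hshift hlim
    ((eventually_gt_atTop 0).mono fun y hy => (tailFun_window_bounds hM hr hy).1)
  have h2 : L ≤ 1 + r * M * L := le_of_tendsto_of_tendsto hlim
    ((hlim.const_mul _).const_add 1)
    ((eventually_gt_atTop 0).mono fun y hy => (tailFun_window_bounds hM hr hy).2)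
  have h3 : L = (1 - r * M)⁻¹ := eq_inv_of_mul_eq_one_left (by linarith)
  rwa [← h3]

/-- Exponential tilting by a root `d` of the characteristic equation turns the tail function of rate
`lam` into that of rate `d + lam`. -/
theorem tailFun_eq_exp_mul {d : ℝ} (hd : d + lam = lam * Real.exp (d * M)) (y : ℝ) :
    tailFun M lam y = Real.exp (-d * y) * tailFun M (d + lam) y := by
  unfold tailFun
  rw [Finset.mul_sum]
  refine Finset.sum_congr rfl fun q _ => ?_
  have e1 : (d + lam) ^ q = lam ^ q * Real.exp (q * (d * M)) := by
    rw [hd, mul_pow, Real.exp_nat_mul]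
  have e2 : Real.exp (lam * (y - q * M)) =
      Real.exp (-d * y) * (Real.exp (q * (d * M)) * Real.exp ((d + lam) * (y - q * M))) := by
    rw [← Real.exp_add, ← Real.exp_add]; ring_nf
  simp only [tailPoly, mul_pow]
  rw [e1, e2]
  ring

/-- The constant in the asymptotics `tailFun M lam y ∼ C * exp (-d * y)` for a load above `1`. -/
noncomputable def tailConst (M lam : ℝ) : ℝ :=
  (1 - (approxRate M lam + lam) * M)⁻¹

/-- The tail function at distance `x` from the empty buffer, for buffer size `l * M`, scaled to
have a limit as `l → ∞`. -/
noncomputable def scaledTail (M lam : ℝ) (l : ℕ) (x : ℝ) : ℝ :=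
  Real.exp (approxRate M lam * (l * M)) * tailFun M lam (l * M - x)

/-- Convergence along this filter is convergence as `l → ∞`, uniformly in `x ≥ 0`. -/
def unifFilter : Filter (ℕ × ℝ) := atTop ×ˢ 𝓟 (Ici 0)

theorem eventually_unifFilter {p : ℕ × ℝ → Prop} :
    (∀ᶠ z in unifFilter, p z) ↔ ∀ᶠ l in atTop, ∀ x : ℝ, 0 ≤ x → p (l, x) := by
  rw [unifFilter, eventually_prod_principal_iff]; rfl

theorem tendsto_fst_unifFilter : Tendsto Prod.fst unifFilter atTop := tendsto_fst

theorem tailConst_pos (hM : 0 < M) (hlam : 0 < lam) (h : 1 < lam * M) : 0 < tailConst M lam :=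
  inv_pos.2 (by linarith [approxRate_add_mul_lt_one hM hlam h])

theorem tendsto_exp_rate (hM : 0 < M) (hlam : 0 < lam) (h : 1 < lam * M) :
    Tendsto (fun l : ℕ => Real.exp (approxRate M lam * (l * M))) atTop (𝓝 0) := by
  refine Real.tendsto_exp_atBot.comp ?_
  exact (tendsto_natCast_atTop_atTop.atTop_mul_const hM).const_mul_atTop_of_neg
    (approxRate_neg hM hlam h)

/-- Uniform convergence of the scaled tail along any choice of nonnegative positions. By tilting, the
error is `exp (d * φ)` times the distance of `tailFun M (d + lam)` from its limit: near the full
buffer the first factor is small, elsewhere the second. -/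
theorem tendsto_scaledTail (hM : 0 < M) (hlam : 0 < lam) (h : 1 < lam * M) {φ : ℕ × ℝ → ℝ}
    (hφ : ∀ᶠ z in unifFilter, 0 ≤ φ z) :
    Tendsto (fun z => scaledTail M lam z.1 (φ z) -
      tailConst M lam * Real.exp (approxRate M lam * φ z)) unifFilter (𝓝 0) := by
  set d := approxRate M lam with hd
  set C := tailConst M lam with hC
  have hroot : d + lam = lam * Real.exp (d * M) := approxRate_add hM hlam
  have hd0 : d < 0 := approxRate_neg hM hlam h
  have hβ : 0 < d + lam := hroot ▸ by positivity
  have hβM : (d + lam) * M < 1 := approxRate_add_mul_lt_one hM hlam h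
  have hCpos : 0 < C := tailConst_pos hM hlam h
  have hbound : ∀ y, |tailFun M (d + lam) y - C| ≤ C := fun y => by
    have h1 := tailFun_nonneg hM hβ y
    have h2 : tailFun M (d + lam) y ≤ C := tailFun_le_of_lt_one hM hβ hβM y
    rw [abs_le]; constructor <;> linarith
  have heq : ∀ (l : ℕ) (x : ℝ), scaledTail M lam l x - C * Real.exp (d * x) =
      Real.exp (d * x) * (tailFun M (d + lam) (l * M - x) - C) := by
    intro l x
    rw [scaledTail, tailFun_eq_exp_mul hroot, ← mul_assoc, ← Real.exp_add,
      show d * (l * M) + -d * (l * M - x) = d * x by ring]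
    ring
  rw [Metric.tendsto_nhds]
  intro ε hε
  obtain ⟨Y, hY⟩ := eventually_atTop.1
    ((tendsto_tailFun hM hβ hβM).eventually (Metric.ball_mem_nhds _ hε))
  have hfar : ∀ᶠ l : ℕ in atTop, Real.exp (d * (l * M)) * (Real.exp (-d * Y) * C) < ε := by
    have := (tendsto_exp_rate hM hlam h).mul_const (Real.exp (-d * Y) * C)
    rw [zero_mul] at this
    exact this.eventually (gt_mem_nhds hε)
  filter_upwards [tendsto_fst_unifFilter.eventually hfar, hφ] with z hz hφz
  rw [Real.dist_eq, sub_zero, heq, abs_mul, Real.abs_exp]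
  rcases le_or_gt Y (z.1 * M - φ z) with h1 | h1
  · have h2 : |tailFun M (d + lam) (z.1 * M - φ z) - C| < ε := hY _ h1
    have h3 : Real.exp (d * φ z) ≤ 1 :=
      Real.exp_le_one_iff.2 (mul_nonpos_of_nonpos_of_nonneg hd0.le hφz)
    calc _ ≤ 1 * |tailFun M (d + lam) (z.1 * M - φ z) - C| := by gcongr
      _ < ε := by rwa [one_mul]
  · have h2 : Real.exp (d * φ z) ≤ Real.exp (d * (z.1 * M) + -d * Y) := by
      refine Real.exp_le_exp.2 ?_
      nlinarith
    calc _ ≤ Real.exp (d * (z.1 * M) + -d * Y) * C :=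
          mul_le_mul h2 (hbound _) (abs_nonneg _) (Real.exp_pos _).le
      _ < ε := by rwa [Real.exp_add, mul_assoc]

/-- Uniform convergence of products to bounded limits. -/
theorem tendsto_mul_sub_mul {ι : Type*} {F : Filter ι} {a a' b b' : ι → ℝ} {A B : ℝ}
    (ha : Tendsto (fun z => a z - a' z) F (𝓝 0)) (hb : Tendsto (fun z => b z - b' z) F (𝓝 0))
    (hA : ∀ᶠ z in F, |a' z| ≤ A) (hB : ∀ᶠ z in F, |b' z| ≤ B) :
    Tendsto (fun z => a z * b z - a' z * b' z) F (𝓝 0) := by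
  have h1 : Tendsto (fun z => (a z - a' z) * b' z) F (𝓝 0) :=
    ha.zero_mul_isBoundedUnder_le ⟨B, by simpa using hB⟩
  have h2 : Tendsto (fun z => a' z * (b z - b' z)) F (𝓝 0) :=
    isBoundedUnder_le_mul_tendsto_zero ⟨A, by simpa using hA⟩ hb
  have h3 := (ha.mul hb).add (h1.add h2)
  simp only [mul_zero, add_zero] at h3
  exact h3.congr fun z => by ring

/-! ### Convergence of the exact and the approximate laws for a load above one -/

/-- The limit of the atom of either law, divided by `exp (d * K)`. -/
noncomputable def atomConst (M lam : ℝ) : ℝ :=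
  (lam * M * tailConst M lam * Real.exp (approxRate M lam * M))⁻¹

/-- The uniform limit of the exact and of the approximate densities. -/
noncomputable def limitPdf (M lam x : ℝ) : ℝ :=
  atomConst M lam * lam * (tailConst M lam * Real.exp (approxRate M lam * max x M) -
    tailConst M lam * Real.exp (approxRate M lam * (x + M)))

theorem tendsto_unifFilter_const {f : ℕ → ℝ} {c : ℝ} (h : Tendsto f atTop (𝓝 c)) :
    Tendsto (fun z : ℕ × ℝ => f z.1 - c) unifFilter (𝓝 0) := by
  have := (h.comp tendsto_fst_unifFilter).sub_const c
  rwa [sub_self] at this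

theorem tendsto_mk_zero_unifFilter : Tendsto (fun l : ℕ => (l, (0 : ℝ))) atTop unifFilter :=
  tendsto_id.prodMk (tendsto_principal.2 (Eventually.of_forall fun _ => self_mem_Ici))

theorem tendsto_scaledTail_const (hM : 0 < M) (hlam : 0 < lam) (h : 1 < lam * M) {x : ℝ}
    (hx : 0 ≤ x) : Tendsto (fun l => scaledTail M lam l x) atTop
      (𝓝 (tailConst M lam * Real.exp (approxRate M lam * x))) := by
  have h1 := tendsto_scaledTail hM hlam h (φ := fun _ => x) (Eventually.of_forall fun _ => hx)
  have h3 := (h1.comp tendsto_mk_zero_unifFilter).add_const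
    (tailConst M lam * Real.exp (approxRate M lam * x))
  rw [zero_add] at h3
  exact h3.congr fun l => by simp

theorem tendsto_scaled_exactAtom (hM : 0 < M) (hlam : 0 < lam) (h : 1 < lam * M) :
    Tendsto (fun l : ℕ => exactAtom M lam (l * M) * Real.exp (-(approxRate M lam * (l * M)))) atTop
      (𝓝 (atomConst M lam)) := by
  have h1 := (tendsto_exp_rate hM hlam h).add
    ((tendsto_scaledTail_const hM hlam h hM.le).const_mul (lam * M))
  have hC := tailConst_pos hM hlam h
  rw [zero_add, ← mul_assoc] at h1
  refine (h1.inv₀ (by positivity)).congr fun l => ?_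
  rw [scaledTail, exactAtom, Real.exp_neg, ← mul_inv]
  congr 1
  ring

theorem scaledTail_sub_eq_sigma1 (hM : 0 < M) {l : ℕ} (hl : 1 ≤ l) :
    scaledTail M lam l 0 - scaledTail M lam l M =
      Real.exp (approxRate M lam * (l * M)) * sigma1 M lam l := by
  rw [sigma1_eq hM hl, scaledTail, scaledTail, sub_zero]
  ring

theorem tendsto_scaled_sigma1 (hM : 0 < M) (hlam : 0 < lam) (h : 1 < lam * M) :
    Tendsto (fun l : ℕ => Real.exp (approxRate M lam * (l * M)) * sigma1 M lam l) atTop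
      (𝓝 (tailConst M lam * (1 - Real.exp (approxRate M lam * M)))) := by
  have h1 := (tendsto_scaledTail_const hM hlam h le_rfl).sub
    (tendsto_scaledTail_const hM hlam h hM.le)
  rw [mul_zero, Real.exp_zero, ← mul_sub] at h1
  exact h1.congr' ((eventually_ge_atTop 1).mono fun l hl => scaledTail_sub_eq_sigma1 hM hl)

/-- The terms of the normalisation that depend on `nc` cancel in the limit, so that the approximate
atom is asymptotic to the exact one whatever the choice of `nc`. -/
theorem tendsto_scaled_approxAtom (hM : 0 < M) (hlam : 0 < lam) (h : 1 < lam * M) {nc : ℕ → ℕ}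
    (hnc : ∀ᶠ l : ℕ in atTop, nc l + 1 ≤ l) :
    Tendsto (fun l : ℕ => approxAtom M lam l (nc l) * Real.exp (-(approxRate M lam * (l * M))))
      atTop (𝓝 (atomConst M lam)) := by
  set d := approxRate M lam with hd
  set C := tailConst M lam with hC
  have hCpos : 0 < C := tailConst_pos hM hlam h
  have hd0 : d < 0 := approxRate_neg hM hlam h
  have hroot : d + lam = lam * Real.exp (d * M) := approxRate_add hM hlam
  have hz : ∀ᶠ l : ℕ in atTop, 0 ≤ (l : ℝ) * M - nc l * M :=
    hnc.mono fun l hl => hM.le.trans (le_mul_sub_mul hM hl)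
  have hz' : ∀ᶠ z in unifFilter, 0 ≤ (z.1 : ℝ) * M - nc z.1 * M :=
    tendsto_fst_unifFilter.eventually hz
  -- the inverse of the scaled atom is `lam / d` times the product in `t2`, plus the difference in
  -- `t1`, plus the term in `t3` (present for `nc = 0` only), plus the limit
  have t1 : Tendsto (fun l : ℕ => scaledTail M lam l (l * M - nc l * M) -
      C * Real.exp (d * (l * M - nc l * M))) atTop (𝓝 0) := by
    have := (tendsto_scaledTail hM hlam h (φ := fun z => (z.1 : ℝ) * M - nc z.1 * M) hz').comp
      tendsto_mk_zero_unifFilter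
    exact this.congr fun l => by rfl
  have t2 : Tendsto (fun l : ℕ => (Real.exp (d * (l * M)) * sigma1 M lam l -
      C * (1 - Real.exp (d * M))) * (Real.exp (d * (l * M - nc l * M)) -
        lam * M * Real.exp (d * M))) atTop (𝓝 0) := by
    have hs := (tendsto_scaled_sigma1 hM hlam h).sub_const (C * (1 - Real.exp (d * M)))
    rw [sub_self] at hs
    refine hs.zero_mul_isBoundedUnder_le (isBoundedUnder_of_eventually_le (a := 1 + lam * M) ?_)
    · filter_upwards [hz] with l hl
      have e1 : Real.exp (d * (l * M - nc l * M)) ≤ 1 :=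
        Real.exp_le_one_iff.2 (mul_nonpos_of_nonpos_of_nonneg hd0.le hl)
      have e2 : Real.exp (d * M) ≤ 1 :=
        Real.exp_le_one_iff.2 (mul_nonpos_of_nonpos_of_nonneg hd0.le hM.le)
      have e3 := Real.exp_pos (d * (l * M - nc l * M))
      have e4 := Real.exp_pos (d * M)
      have e5 : lam * M * Real.exp (d * M) ≤ lam * M * 1 := by gcongr
      have e6 : 0 < lam * M * Real.exp (d * M) := by positivity
      simp only [Function.comp_apply, Real.norm_eq_abs]
      rw [abs_le]
      constructor <;> linarith
  have t3 : Tendsto (fun l : ℕ => Real.exp (d * (l * M)) * (if nc l = 0 then 1 else 0)) atTop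
      (𝓝 0) := by
    refine squeeze_zero (fun l => by positivity) (fun l => ?_) (tendsto_exp_rate hM hlam h)
    refine mul_le_of_le_one_right (Real.exp_pos _).le ?_
    split_ifs <;> norm_num
  have t4 := ((t2.const_mul (lam / d)).add t1).add t3 |>.add_const
    (lam * M * C * Real.exp (d * M))
  rw [mul_zero, zero_add, zero_add, zero_add] at t4
  have hne : lam * M * C * Real.exp (d * M) ≠ 0 := by positivity
  have t5 := t4.inv₀ hne
  rw [atomConst, ← hd, ← hC]
  refine t5.congr fun l => ?_
  rw [approxAtom_eq hM, Real.exp_neg, ← mul_inv]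
  congr 1
  have e1 : (if nc l = 0 then 1 else tailFun M lam (nc l * M)) =
      tailFun M lam (nc l * M) + if nc l = 0 then 1 else 0 := by
    split_ifs with h0
    · simp [h0, tailFun_of_nonpos hM]
    · simp
  have e2 : scaledTail M lam l (l * M - nc l * M) =
      Real.exp (d * (l * M)) * tailFun M lam (nc l * M) := by
    rw [scaledTail, sub_sub_cancel]
  rw [e1, e2, sigma2, if_neg h.ne']
  have hd1 := hd0.ne
  -- by this identity the contributions `exp (d * (K - nc * M))` of `t1` and `t2` cancel
  have e3 : lam / d * (1 - Real.exp (d * M)) = -1 := by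
    rw [div_mul_eq_mul_div, div_eq_iff hd1]
    linarith
  rw [← hd]
  linear_combination (-C * (Real.exp (d * (l * M - nc l * M)) - lam * M * Real.exp (d * M))) * e3

theorem abs_exp_rate_le (hM : 0 < M) (hlam : 0 < lam) (h : 1 < lam * M) {x : ℝ} (hx : 0 ≤ x) :
    |Real.exp (approxRate M lam * x)| ≤ 1 := by
  rw [Real.abs_exp]
  exact Real.exp_le_one_iff.2
    (mul_nonpos_of_nonpos_of_nonneg (approxRate_neg hM hlam h).le hx)

theorem unifFilter_nonneg : ∀ᶠ z in unifFilter, 0 ≤ z.2 :=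
  eventually_unifFilter.2 (Eventually.of_forall fun _ _ hx => hx)

/-- Uniform convergence of `A l * lam * (difference of tails)`, the common form of the exact density
and of the top part of the approximate one. -/
theorem tendsto_mul_scaledTail_sub (hM : 0 < M) (hlam : 0 < lam) (h : 1 < lam * M) {A : ℕ → ℝ}
    {α : ℝ} (hA : Tendsto A atTop (𝓝 α)) {φ χ : ℕ × ℝ → ℝ} (hφ : ∀ z, 0 ≤ z.2 → 0 ≤ φ z)
    (hχ : ∀ z, 0 ≤ z.2 → 0 ≤ χ z) :
    Tendsto (fun z => A z.1 * lam * (scaledTail M lam z.1 (φ z) - scaledTail M lam z.1 (χ z)) -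
      α * lam * (tailConst M lam * Real.exp (approxRate M lam * φ z) -
        tailConst M lam * Real.exp (approxRate M lam * χ z))) unifFilter (𝓝 0) := by
  have hC := tailConst_pos hM hlam h
  have h1 := tendsto_scaledTail hM hlam h (unifFilter_nonneg.mono hφ)
  have h2 := tendsto_scaledTail hM hlam h (unifFilter_nonneg.mono hχ)
  refine tendsto_mul_sub_mul (A := |α * lam|) (B := 2 * tailConst M lam)
    (tendsto_unifFilter_const (hA.mul_const lam)) ?_ (Eventually.of_forall fun _ => le_rfl) ?_
  · have := h1.sub h2
    rw [sub_zero] at this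
    exact this.congr fun z => by ring
  · filter_upwards [unifFilter_nonneg] with z hz
    have e1 := abs_exp_rate_le hM hlam h (hφ z hz)
    have e2 := abs_exp_rate_le hM hlam h (hχ z hz)
    rw [← mul_sub, abs_mul, abs_of_pos hC, mul_comm]
    refine mul_le_mul_of_nonneg_right ((abs_sub _ _).trans ?_) hC.le
    linarith

/-- The exact densities converge to `limitPdf`, uniformly on `x ≥ 0`. -/
theorem tendsto_exactPdf (hM : 0 < M) (hlam : 0 < lam) (h : 1 < lam * M) :
    Tendsto (fun z : ℕ × ℝ => exactPdf M lam (z.1 * M) z.2 - limitPdf M lam z.2) unifFilter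
      (𝓝 0) := by
  refine (tendsto_mul_scaledTail_sub hM hlam h (tendsto_scaled_exactAtom hM hlam h)
    (φ := fun z => max z.2 M) (χ := fun z => z.2 + M) (fun z hz => le_max_of_le_left hz)
    (fun z hz => by linarith)).congr fun z => ?_
  have e : Real.exp (-(approxRate M lam * (z.1 * M))) * Real.exp (approxRate M lam * (z.1 * M)) =
      1 := by rw [← Real.exp_add]; simp
  rw [exactPdf, limitPdf, scaledTail, scaledTail, show (z.1 : ℝ) * M - (z.2 + M) = z.1 * M - M - z.2
    by ring]
  linear_combination (exactAtom M lam (z.1 * M) * lam * (tailFun M lam (z.1 * M - max z.2 M) -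
    tailFun M lam (z.1 * M - M - z.2))) * e

/-- The limit density on the first section. -/
theorem limitPdf_of_le (hM : 0 < M) (hlam : 0 < lam) (h : 1 < lam * M) {x : ℝ} (hx : x ≤ M) :
    limitPdf M lam x = (1 - Real.exp (approxRate M lam * x)) / M := by
  have hC := tailConst_pos hM hlam h
  have e : Real.exp (approxRate M lam * (x + M)) =
      Real.exp (approxRate M lam * x) * Real.exp (approxRate M lam * M) := by
    rw [← Real.exp_add]; ring_nf
  rw [limitPdf, max_eq_right hx, e, atomConst]
  field_simp

/-- The approximate densities converge to `limitPdf`, uniformly on `[0, K)`: each of the three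
expressions converges uniformly on all of `x ≥ 0`, and its limit agrees with `limitPdf` where the
expression is used. -/
theorem tendsto_approxPdf (hM : 0 < M) (hlam : 0 < lam) (h : 1 < lam * M) {nc : ℕ → ℕ}
    (hnc : ∀ᶠ l : ℕ in atTop, nc l + 1 ≤ l) {ε : ℝ} (hε : 0 < ε) :
    ∀ᶠ l : ℕ in atTop, ∀ x ∈ Ico (0 : ℝ) (l * M),
      |approxPdf M lam l (nc l) x - limitPdf M lam x| < ε := by
  have hC := tailConst_pos hM hlam h
  have hroot := approxRate_add hM hlam
  have hd1 := (approxRate_neg hM hlam h).ne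
  have hatom := tendsto_scaled_approxAtom hM hlam h hnc
  have hcoef : Tendsto (fun l : ℕ => approxCoeff M lam l (nc l)) atTop
      (𝓝 (atomConst M lam * lam * (tailConst M lam * (1 - Real.exp (approxRate M lam * M))))) := by
    refine ((hatom.mul_const lam).mul (tendsto_scaled_sigma1 hM hlam h)).congr fun l => ?_
    have e : Real.exp (-(approxRate M lam * (l * M))) * Real.exp (approxRate M lam * (l * M)) =
        1 := by rw [← Real.exp_add]; simp
    rw [approxCoeff]
    linear_combination (approxAtom M lam l (nc l) * lam * sigma1 M lam l) * e
  have hbdd : ∀ᶠ z in unifFilter, |Real.exp (approxRate M lam * z.2)| ≤ 1 :=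
    unifFilter_nonneg.mono fun z hz => abs_exp_rate_le hM hlam h hz
  have hzero : Tendsto (fun _ : ℕ × ℝ => (0 : ℝ)) unifFilter (𝓝 0) := tendsto_const_nhds
  have p1 := tendsto_mul_sub_mul (tendsto_unifFilter_const (hcoef.mul_const
      (lam * Real.exp (approxRate M lam * M) / approxRate M lam)))
    (b := fun z => Real.exp (approxRate M lam * z.2) - 1)
    (b' := fun z => Real.exp (approxRate M lam * z.2) - 1)
    (hzero.congr fun z => (sub_self _).symm) (Eventually.of_forall fun _ => le_rfl) (B := 2)
    (hbdd.mono fun z hz => by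
      rw [abs_le] at hz ⊢
      constructor <;> linarith [hz.1, hz.2])
  have p2 := tendsto_mul_sub_mul (tendsto_unifFilter_const hcoef)
    (b := fun z => Real.exp (approxRate M lam * z.2))
    (b' := fun z => Real.exp (approxRate M lam * z.2))
    (hzero.congr fun z => (sub_self _).symm) (Eventually.of_forall fun _ => le_rfl) hbdd
  have p3 := tendsto_mul_scaledTail_sub hM hlam h hatom (φ := fun z => z.2)
    (χ := fun z => z.2 + M) (fun z hz => hz) (fun z hz => by linarith)
  have hball := Metric.ball_mem_nhds (0 : ℝ) hε
  have hexp : ∀ x : ℝ, Real.exp (approxRate M lam * (x + M)) =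
      Real.exp (approxRate M lam * x) * Real.exp (approxRate M lam * M) := by
    intro x; rw [← Real.exp_add]; ring_nf
  filter_upwards [hnc, eventually_unifFilter.1 (p1.eventually hball),
    eventually_unifFilter.1 (p2.eventually hball), eventually_unifFilter.1 (p3.eventually hball)]
    with l hl q1 q2 q3 x hx
  replace q1 := q1 x hx.1
  replace q2 := q2 x hx.1
  replace q3 := q3 x hx.1
  rw [Real.dist_eq, sub_zero] at q1 q2 q3
  rcases lt_or_ge x M with h1 | h1
  · convert q1 using 2
    rw [approxPdf_of_lt h1, approxFirst, if_neg h.ne', limitPdf, max_eq_right h1.le, hexp]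
    have e3 : lam * (1 - Real.exp (approxRate M lam * M)) / approxRate M lam = -1 := by
      rw [div_eq_iff hd1]; linarith
    linear_combination (atomConst M lam * lam * tailConst M lam * Real.exp (approxRate M lam * M) *
      (Real.exp (approxRate M lam * x) - 1)) * e3
  rcases lt_or_ge x (l * M - nc l * M) with h2 | h2
  · convert q2 using 2
    rw [approxPdf_of_mid h1 h2, approxMiddle, limitPdf, max_eq_left h1, hexp]
    ring
  · convert q3 using 2
    rw [approxPdf_of_ge hM hl h2 hx.2, limitPdf, max_eq_left h1, scaledTail, scaledTail,
      sub_add_eq_sub_sub]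
    have e : Real.exp (-(approxRate M lam * (l * M))) * Real.exp (approxRate M lam * (l * M)) =
        1 := by rw [← Real.exp_add]; simp
    linear_combination (-(approxAtom M lam l (nc l) * lam * (tailFun M lam (l * M - x) -
      tailFun M lam (l * M - x - M)))) * e

theorem tendsto_zero_of_scaled (hM : 0 < M) (hlam : 0 < lam) (h : 1 < lam * M) {a : ℕ → ℝ} {α : ℝ}
    (ha : Tendsto (fun l : ℕ => a l * Real.exp (-(approxRate M lam * (l * M)))) atTop (𝓝 α)) :
    Tendsto a atTop (𝓝 0) := by
  have := ha.mul (tendsto_exp_rate hM hlam h)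
  rw [mul_zero] at this
  refine this.congr fun l => ?_
  rw [mul_assoc, ← Real.exp_add]
  simp

end EnergyBuffer

theorem proposition1 (M lam : ℝ) (hM : 0 < M) (hlam : 0 < lam) :
    -- the storage process with `K = l * M` has a limiting pdf and a limiting full-buffer probability
    (∀ l : ℕ, 2 ≤ l → ∃ (g : ℝ → ℝ) (a : ℝ), IsLimitingPdf M lam (l * M) g a) ∧
    -- the approximate distribution, for every admissible `nc`
    (∀ l nc : ℕ, 2 ≤ l → nc + 1 ≤ l →
      -- it is a probability distribution (unit area)
      (0 < approxAtom M lam l nc ∧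
        (∀ x ∈ Ico (0 : ℝ) (l * M), 0 ≤ approxPdf M lam l nc x) ∧
        IntervalIntegrable (approxPdf M lam l nc) volume 0 (l * M) ∧
        (∫ x in (0 : ℝ)..(l * M), approxPdf M lam l nc x) + approxAtom M lam l nc = 1) ∧
      -- on `[0, M)` it solves the Volterra equation driven by the exponential `c * exp (d * x)`
      (∀ x ∈ Ico (0 : ℝ) M,
        approxPdf M lam l nc x =
          (∫ u in (0 : ℝ)..x, lam * Real.exp (-lam * (x - u)) * approxPdf M lam l nc u) +
          ∫ u in M..(M + x), lam * Real.exp (-lam * (x - u + M)) * approxMiddle M lam l nc u) ∧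
      -- on `[K - nc * M, K)` it is the exact pdf, rescaled by the ratio of the atoms
      (∀ (g : ℝ → ℝ) (a : ℝ), IsLimitingPdf M lam (l * M) g a →
        0 < a ∧ ∀ x ∈ Ico ((l : ℝ) * M - nc * M) (l * M),
          approxPdf M lam l nc x = approxAtom M lam l nc / a * g x)) ∧
    -- for `δ > 1` the approximation error vanishes as `K = l * M → ∞`
    (1 < lam * M →
      ∀ (g : ℕ → ℝ → ℝ) (a : ℕ → ℝ) (nc : ℕ → ℕ),
        (∀ l : ℕ, 2 ≤ l → IsLimitingPdf M lam (l * M) (g l) (a l)) →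
        (∀ᶠ l : ℕ in atTop, nc l + 1 ≤ l) →
        (∀ ε : ℝ, 0 < ε → ∀ᶠ l : ℕ in atTop, ∀ x ∈ Ico (0 : ℝ) (l * M),
          |g l x - approxPdf M lam l (nc l) x| < ε) ∧
        Tendsto a atTop (𝓝 0) ∧
        Tendsto (fun l => approxAtom M lam l (nc l)) atTop (𝓝 0) ∧
        TendstoUniformlyOn g
          (fun x => (1 - Real.exp ((-(lam * M) -
            lambertW0 (-(lam * M) * Real.exp (-(lam * M)))) / M * x)) / M) atTop (Icc 0 M) ∧
        TendstoUniformlyOn (fun l => approxPdf M lam l (nc l))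
          (fun x => (1 - Real.exp ((-(lam * M) -
            lambertW0 (-(lam * M) * Real.exp (-(lam * M)))) / M * x)) / M) atTop (Icc 0 M)) := by
  have hKM : ∀ l : ℕ, 2 ≤ l → 2 * M ≤ (l : ℝ) * M := fun l hl => by
    have : (2 : ℝ) ≤ l := by exact_mod_cast hl
    gcongr
  refine ⟨fun l hl => ⟨_, _, isLimitingPdf_exactPdf hM hlam (hKM l hl)⟩, ?_, ?_⟩
  · intro l nc hl hnc
    obtain ⟨hint, harea⟩ := intervalIntegrable_and_integral_approxPdf hM hlam hnc
    refine ⟨⟨approxAtom_pos hM hlam hnc, fun x hx => approxPdf_nonneg hM hlam hnc hx.1 hx.2,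
      hint, harea⟩, fun x hx => approxPdf_volterra hM hlam l nc hx.1 hx.2, fun g a hga => ?_⟩
    obtain ⟨rfl, hg⟩ := hga.eq_exact hM hlam (hKM l hl)
    have ha := exactAtom_pos (K := (l : ℝ) * M) hM hlam
    refine ⟨ha, fun x hx => ?_⟩
    have hMx : M ≤ x := (le_mul_sub_mul hM hnc).trans hx.1
    rw [hg ⟨hM.le.trans hMx, hx.2⟩, approxPdf_of_ge hM hnc hx.1 hx.2, exactPdf_of_ge hMx]
    field_simp
  · intro h g a nc hga hnc
    have hexact : ∀ ε : ℝ, 0 < ε → ∀ᶠ l : ℕ in atTop, ∀ x ∈ Ico (0 : ℝ) (l * M),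
        |g l x - limitPdf M lam x| < ε := by
      intro ε hε
      filter_upwards [eventually_ge_atTop 2, eventually_unifFilter.1
        ((tendsto_exactPdf hM hlam h).eventually (Metric.ball_mem_nhds 0 hε))] with l hl hd x hx
      rw [((hga l hl).eq_exact hM hlam (hKM l hl)).2 hx]
      simpa [Real.dist_eq] using hd x hx.1
    have happrox := fun ε (hε : 0 < ε) => tendsto_approxPdf hM hlam h hnc hε
    have huniform : ∀ f : ℕ → ℝ → ℝ, (∀ ε : ℝ, 0 < ε → ∀ᶠ l : ℕ in atTop,
        ∀ x ∈ Ico (0 : ℝ) (l * M), |f l x - limitPdf M lam x| < ε) →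
        TendstoUniformlyOn f (fun x => (1 - Real.exp ((-(lam * M) -
          lambertW0 (-(lam * M) * Real.exp (-(lam * M)))) / M * x)) / M) atTop (Icc 0 M) := by
      intro f hf
      rw [Metric.tendstoUniformlyOn_iff]
      intro ε hε
      filter_upwards [eventually_ge_atTop 2, hf ε hε] with l hl hd x hx
      -- the closed interval `[0, M]` lies in `[0, K)` because `l ≥ 2`
      have := hd x ⟨hx.1, by linarith [hx.2, hKM l hl]⟩
      rw [limitPdf_of_le hM hlam h hx.2, approxRate, if_neg (not_le.2 h)] at this
      rwa [dist_comm, Real.dist_eq]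
    refine ⟨fun ε hε => ?_, ?_, tendsto_zero_of_scaled hM hlam h
      (tendsto_scaled_approxAtom hM hlam h hnc), huniform _ hexact, huniform _ happrox⟩
    · filter_upwards [hexact (ε / 2) (half_pos hε), happrox (ε / 2) (half_pos hε)] with l h1 h2 x hx
      calc |g l x - approxPdf M lam l (nc l) x|
          ≤ |g l x - limitPdf M lam x| + |limitPdf M lam x - approxPdf M lam l (nc l) x| :=
            abs_sub_le _ _ _
        _ < ε / 2 + ε / 2 := add_lt_add (h1 x hx) (by rw [abs_sub_comm]; exact h2 x hx)
        _ = ε := add_halves ε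
    · refine (tendsto_zero_of_scaled hM hlam h (tendsto_scaled_exactAtom hM hlam h)).congr' ?_
      filter_upwards [eventually_ge_atTop 2] with l hl
      exact ((hga l hl).eq_exact hM hlam (hKM l hl)).1.symm
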